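/- Let $D\ge 0$, $\varepsilon>0$, and let $p_0,p_1$ be absolutely continuous Borel probability measures on $\mathbb{R}^D$ (we also write $p_0$ for the density). Let $\Pi(p_0,p_1)$ be the set of couplings of $p_0$ and $p_1$, and let $\pi^*$ be an entropic optimal transport plan, i.e. a minimizer over $\pi\in\Pi(p_0,p_1)$ of $$\mathbb{E}_{\pi}\Big[\tfrac12\|x_0-x_1\|^2\Big]-\varepsilon\int_{\mathbb{R}^D} H\big(\pi(\cdot\mid x_0)\big)\,p_0(x_0)\,dx_0 ,$$ where $H$ is the differential entropy ($H=-\infty$ for a measure without density) and the objective is $+\infty$ if the first term is. For measurable $f,\xi:\mathbb{R}^D\to\mathbb{R}$ put $$\mathcal{L}(f,\xi)=\varepsilon\Big(1-\tfrac D2\log(2\pi\varepsilon)\Big)+\mathbb{E}_{p_1}[f]-\varepsilon\,\mathbb{E}_{p_0}[\xi]-\varepsilon\,\mathbb{E}_{x_0\sim p_0}\mathbb{E}_{z\sim\mathcal N(0,I)}\exp\Big(\tfrac{f(x_0+\sqrt\varepsilon z)}{\varepsilon}-\xi(x_0)\Big),$$ which is well defined in $[-\infty,\infty)$ if $f^+\in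 L^1(p_1)$ and $\xi^-\in L^1(p_0)$; let $\mathcal{L}^*=\sup_{f,\xi}\mathcal{L}(f,\xi)$ over measurable $f\in L^1(p_1)$, $\xi\in L^1(p_0)$. Let $\pi^{f,\xi}$ be the non-negative measure on $\mathbb{R}^D\times\mathbb{R}^D$ with density $$\pi^{f,\xi}(x_0,x_1)=\frac{(2\pi\varepsilon)^{-D/2}\,p_0(x_0)}{\exp(\xi(x_0))}\exp\Big[\frac{f(x_1)-\frac12\|x_0-x_1\|^2}{\varepsilon}\Big],$$ and let $\pi^f=\pi^{f,\xi^*}$ with $\xi^*(x_0)=\log Z(f,x_0)-\frac D2\log(2\pi\varepsilon)$, $Z(f,x_0)=\int\exp\big((f(x_1)-\frac12\|x_0-x_1\|^2)/\varepsilon\big)dx_1$ (at points where $Z(f,x_0)=\infty$, $\xi^*$ takes the value $-\frac D2\log(2\pi\varepsilon)$). For non-negative measures $\mu,\nu$ let $$\mathrm{KL}(\mu\|\nu)=\int\Big[\tfrac{d\mu}{d\nu}\log\tfrac{d\mu}{d\nu}-\tfrac{d\mu}{d\nu}+1\Big]d\nu\in[0,\infty]$$ if $\mu\ll\nu$, and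 $\mathrm{KL}(\mu\|\nu)=\infty$ otherwise. Then for all measurable $f,\xi:\mathbb{R}^D\to\mathbb{R}$, $$\varepsilon\,\mathrm{KL}(\pi^*\|\pi^f)\le\varepsilon\,\mathrm{KL}(\pi^*\|\pi^{f,\xi}),$$ and if $f^+\in L^1(p_1)$ and $\xi^-\in L^1(p_0)$, so that $\mathcal{L}(f,\xi)$ is defined, then $$\varepsilon\,\mathrm{KL}(\pi^*\|\pi^{f,\xi})=\mathcal{L}^*-\mathcal{L}(f,\xi),$$ as an identity between extended real numbers. -/

import Mathlib

open MeasureTheory ProbabilityTheory InformationTheory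
open scoped ENNReal

noncomputable section

/-- Euclidean space of dimension `D`. -/
abbrev Euc (D : ℕ) : Type := EuclideanSpace ℝ (Fin D)

/-- Extended integral `∫ g⁺ dμ - ∫ g⁻ dμ`; meaningful as soon as one of the two parts is finite,
and equal to the usual integral when `g` is real-valued and integrable. -/
def extIntegral {α : Type*} [MeasurableSpace α] (μ : Measure α) (g : α → EReal) : EReal :=
  ((∫⁻ x, (g x).toENNReal ∂μ : ℝ≥0∞) : EReal) - ((∫⁻ x, (-g x).toENNReal ∂μ : ℝ≥0∞) : EReal)

/-- Kullback–Leibler divergence between non-negative (possibly infinite) measures: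
`∫ (t log t - t + 1) dν` with `t = dμ/dν` if `μ ≪ ν`, and `∞` otherwise.
(`klFun t = t * log t + 1 - t`.) -/
def genKL {α : Type*} [MeasurableSpace α] (μ ν : Measure α) : ℝ≥0∞ :=
  open Classical in
  if μ ≪ ν then ∫⁻ x, ENNReal.ofReal (klFun (μ.rnDeriv ν x).toReal) ∂ν else ∞

/-- `γ ∈ Π(p₀, p₁)`: the marginals of `γ` are `p₀` and `p₁`. -/
def IsCoupling {D : ℕ} (p₀ p₁ : Measure (Euc D)) (γ : Measure (Euc D × Euc D)) : Prop :=
  γ.fst = p₀ ∧ γ.snd = p₁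

/-- Differential entropy `-∫ ρ log ρ dx` of a measure with Lebesgue density `ρ`;
`-∞` for a measure without density. -/
def diffEntropy {D : ℕ} (μ : Measure (Euc D)) : EReal :=
  open Classical in
  if μ ≪ volume then
    extIntegral μ (fun x => ((-Real.log (μ.rnDeriv volume x).toReal : ℝ) : EReal))
  else ⊥

/-- Transport cost `𝔼_γ ‖x₀ - x₁‖² / 2`. -/
def transportCost {D : ℕ} (γ : Measure (Euc D × Euc D)) : ℝ≥0∞ :=
  ∫⁻ z, ENNReal.ofReal (‖z.1 - z.2‖ ^ 2 / 2) ∂γ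

/-- Primal objective `𝔼_γ ‖x₀ - x₁‖² / 2 - ε ∫ H(γ(· ∣ x₀)) p₀(dx₀)`, with `p₀` the first marginal
of `γ`. It is `+∞` if the transport cost is; if the cost is finite, then the integral of the
entropies is well defined in `[-∞, ∞)`. -/
def eotObjective {D : ℕ} (ε : ℝ) (γ : Measure (Euc D × Euc D)) [IsFiniteMeasure γ] : EReal :=
  open Classical in
  if transportCost γ = ∞ then ⊤
  else (transportCost γ : EReal)
    - (ε : EReal) * extIntegral γ.fst (fun x₀ => diffEntropy (γ.condKernel x₀))

/-- `γ` is an entropic optimal transport plan between `p₀` and `p₁`: a coupling that minimizes the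
primal objective among all couplings. -/
def IsEOTPlan {D : ℕ} (ε : ℝ) (p₀ p₁ : Measure (Euc D)) (γ : Measure (Euc D × Euc D))
    [IsFiniteMeasure γ] : Prop :=
  IsCoupling p₀ p₁ γ ∧
    ∀ (γ' : Measure (Euc D × Euc D)) [IsFiniteMeasure γ'], IsCoupling p₀ p₁ γ' →
      eotObjective ε γ ≤ eotObjective ε γ'

/-- Partition function `Z(f, x₀) = ∫ exp ((f x₁ - ‖x₀ - x₁‖² / 2) / ε) dx₁`. -/
def partitionFn {D : ℕ} (ε : ℝ) (f : Euc D → ℝ) (x₀ : Euc D) : ℝ≥0∞ :=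
  ∫⁻ x₁, ENNReal.ofReal (Real.exp ((f x₁ - ‖x₀ - x₁‖ ^ 2 / 2) / ε))

/-- `ξ*(x₀) = log Z(f, x₀) - (D / 2) log (2πε)`. (Where `Z(f, x₀) = ∞` the value is a dummy one;
if that happens with positive `p₀`-probability, then the measure `gibbsPlanOpt` below has infinite
mass and every probability measure has infinite divergence from it.) -/
def xiOpt {D : ℕ} (ε : ℝ) (f : Euc D → ℝ) (x₀ : Euc D) : ℝ :=
  Real.log (partitionFn ε f x₀).toReal - (D : ℝ) / 2 * Real.log (2 * Real.pi * ε)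

/-- The measure `π^{f,ξ}` with Lebesgue density
`(2πε)^{-D/2} p₀(x₀) exp (-ξ x₀) exp ((f x₁ - ‖x₀ - x₁‖² / 2) / ε)`. -/
def gibbsPlan {D : ℕ} (ε : ℝ) (p₀ : Measure (Euc D)) (f ξ : Euc D → ℝ) :
    Measure (Euc D × Euc D) :=
  (volume : Measure (Euc D × Euc D)).withDensity fun z =>
    p₀.rnDeriv volume z.1 *
      ENNReal.ofReal ((2 * Real.pi * ε) ^ (-(D : ℝ) / 2) / Real.exp (ξ z.1) *
        Real.exp ((f z.2 - ‖z.1 - z.2‖ ^ 2 / 2) / ε))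

/-- The measure `π^f = π^{f,ξ*}`. -/
def gibbsPlanOpt {D : ℕ} (ε : ℝ) (p₀ : Measure (Euc D)) (f : Euc D → ℝ) :
    Measure (Euc D × Euc D) :=
  gibbsPlan ε p₀ f (xiOpt ε f)

/-- Variational dual objective
`L(f, ξ) = ε (1 - (D/2) log (2πε)) + 𝔼_{p₁} f - ε 𝔼_{p₀} ξ
  - ε 𝔼_{x₀ ∼ p₀} 𝔼_{z ∼ N(0, I)} exp (f (x₀ + √ε z) / ε - ξ x₀)`,
with values in `[-∞, ∞)` as soon as `f⁺` is `p₁`-integrable and `ξ⁻` is `p₀`-integrable. -/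
def varObjective {D : ℕ} (ε : ℝ) (p₀ p₁ : Measure (Euc D)) (f ξ : Euc D → ℝ) : EReal :=
  ((ε * (1 - (D : ℝ) / 2 * Real.log (2 * Real.pi * ε)) : ℝ) : EReal)
    + extIntegral p₁ (fun x₁ => (f x₁ : EReal))
    - (ε : EReal) * extIntegral p₀ (fun x₀ => (ξ x₀ : EReal))
    - (ε : EReal) * ((∫⁻ x₀, ∫⁻ z,
        ENNReal.ofReal (Real.exp (f (x₀ + Real.sqrt ε • z) / ε - ξ x₀))
          ∂(stdGaussian (Euc D)) ∂p₀ : ℝ≥0∞) : EReal)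

/-- The optimal value `L*`: supremum of `L(f, ξ)` over measurable `f ∈ L¹(p₁)`, `ξ ∈ L¹(p₀)`. -/
def varOptimum {D : ℕ} (ε : ℝ) (p₀ p₁ : Measure (Euc D)) : EReal :=
  sSup {v | ∃ f ξ : Euc D → ℝ, Measurable f ∧ Measurable ξ ∧ Integrable f p₁ ∧ Integrable ξ p₀ ∧
    v = varObjective ε p₀ p₁ f ξ}

end

/-!
Let `R = p₀ ⊗ₘ heatKernel D ε` be the law of `(x₀, x₀ + √ε z)`, with `z` a standard Gaussian vector.
The whole theorem is about the divergence from the probability measure `R`.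

*Gibbs measures.* The measure `π^{f,ξ}` is the tilt `exp (f x₁ / ε - ξ x₀) R` (`gibbsPlan_eq`). The
elementary identity `genKL_withDensity_exp` for tilted reference measures then gives, for all
couplings `γ` and all potentials for which `L(f, ξ)` is defined,
`ε KL(γ ‖ π^{f,ξ}) = ε KL(γ ‖ R) - (D / 2) ε log (2πε) - L(f, ξ)` (`mul_genKL_gibbsPlan_add`).
It is stated as an equality of sums of non-negative terms, so that infinite values need no separate
treatment. The same identity with `π^f` in place of `R` shows that `π^f` is the best normalization:
the inequality reduces to `1 + a ≤ exp a` (`genKL_gibbsPlanOpt_le`).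

*Primal problem.* By the chain rule, the primal objective of a coupling with finite cost is
`ε KL(γ ‖ R) - (D / 2) ε log (2πε)` (`eotObjective_eq`), and `KL(γ ‖ R) < ∞` forces the cost to be
finite (`transportCost_ne_top`). So it remains to prove that `L*` is the minimum of this quantity
over couplings. One inequality is the identity above.

*Strong duality.* The other inequality holds for any probability measure `R` on a product space,
without topology or compactness (`exists_measure_genKL_le`, `exists_coupling_genKL_le`). Take
simple potentials with sums `gₙ`, along which the dual functional `J` tends to its supremum. The
concavity defect of `J` at a midpoint is the squared distance of the functions `exp (gₙ / 2)` in
`L²(R)`; hence these form a Cauchy sequence, with limit `h`, say. Put `Q = h² R`. Since no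
perturbation of `gₙ` increases `J` much, `Q` has the right marginals. Perturbing `gₙ` to
`(1 - s) gₙ` and applying Fatou's lemma twice, as `n → ∞` and then as `s → 0`, shows that `KL(Q ‖ R)`
is at most the supremum of `J`. In particular a finite supremum makes the primal problem finite,
and if no coupling has finite divergence from `R`, both sides are infinite.
-/

/-! ### Extended integrals -/

lemma coe_sub_coe_eq_of_add_eq_add {P N U V : ℝ≥0∞} (hU : U ≠ ∞) (hP : P ≠ ∞)
    (h : P + V = N + U) : (P : EReal) - (N : EReal) = (U : EReal) - (V : EReal) := by
  lift U to NNReal using hU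
  lift P to NNReal using hP
  induction N with
  | top =>
    have hV : V = ∞ := by simpa using h
    simp [hV, EReal.sub_top]
  | coe N =>
    have hV : V ≠ ∞ := by
      rintro rfl
      rw [add_top, ← ENNReal.coe_add] at h
      exact ENNReal.coe_ne_top h.symm
    lift V to NNReal using hV
    have h' : (P : ℝ) + V = N + U := by exact_mod_cast h
    have : (P : ℝ) - N = U - V := by linarith
    rw [EReal.coe_nnreal_eq_coe_real, EReal.coe_nnreal_eq_coe_real, EReal.coe_nnreal_eq_coe_real,
      EReal.coe_nnreal_eq_coe_real, ← EReal.coe_sub, ← EReal.coe_sub, this]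

lemma EReal.coe_sub_toENNReal_add (u v : ℝ≥0∞) (hu : u ≠ ∞) :
    ((u : EReal) - v).toENNReal + v = (-((u : EReal) - v)).toENNReal + u := by
  lift u to NNReal using hu
  induction v with
  | top => simp [EReal.sub_top]
  | coe v =>
    have h1 : ((u : ℝ≥0∞) : EReal) - ((v : ℝ≥0∞) : EReal) = (((u : ℝ) - v : ℝ) : EReal) := by
      push_cast; rfl
    rw [h1, ← EReal.coe_neg, EReal.real_coe_toENNReal, EReal.real_coe_toENNReal]
    rw [← ENNReal.ofReal_coe_nnreal, ← ENNReal.ofReal_coe_nnreal]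
    rcases le_total (u : ℝ) v with h | h
    · rw [ENNReal.ofReal_of_nonpos (by linarith), ← ENNReal.ofReal_add (by linarith) (by positivity)]
      simp
    · rw [ENNReal.ofReal_of_nonpos (p := -_) (by linarith),
        ← ENNReal.ofReal_add (by linarith) (by positivity)]
      simp

/-- The extended integral does not depend on the way its argument is written as a difference of
non-negative functions, as long as the first one is integrable. -/
lemma extIntegral_eq_sub {α : Type*} [MeasurableSpace α] {μ : Measure α} {g : α → EReal}
    {u v : α → ℝ≥0∞} (hu : AEMeasurable u μ) (hv : AEMeasurable v μ)
    (hU : ∫⁻ x, u x ∂μ ≠ ∞) (hg : ∀ᵐ x ∂μ, g x = u x - v x) :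
    extIntegral μ g = ((∫⁻ x, u x ∂μ : ℝ≥0∞) : EReal) - ((∫⁻ x, v x ∂μ : ℝ≥0∞) : EReal) := by
  have hfin := ae_lt_top' hu hU
  refine coe_sub_coe_eq_of_add_eq_add hU (ne_top_of_le_ne_top hU (lintegral_mono_ae ?_)) ?_
  · filter_upwards [hg] with x hx
    rw [hx]
    calc ((u x : EReal) - v x).toENNReal ≤ (u x : EReal).toENNReal :=
          EReal.toENNReal_le_toENNReal
            (EReal.sub_le_of_le_add (le_add_of_nonneg_right (EReal.coe_ennreal_nonneg _)))
      _ = u x := EReal.toENNReal_coe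
  · rw [← lintegral_add_right' _ hv, ← lintegral_add_right' _ hu]
    refine lintegral_congr_ae ?_
    filter_upwards [hg, hfin] with x hx hx'
    rw [hx]
    exact EReal.coe_sub_toENNReal_add _ _ hx'.ne

/-! ### Kullback–Leibler divergence between non-negative measures -/

section Tilting

variable {α : Type*} [MeasurableSpace α]

lemma genKL_of_ac {μ ν : Measure α} (h : μ ≪ ν) :
    genKL μ ν = ∫⁻ x, ENNReal.ofReal (klFun (μ.rnDeriv ν x).toReal) ∂ν := by
  simp [genKL, h]

lemma genKL_of_not_ac {μ ν : Measure α} (h : ¬ μ ≪ ν) : genKL μ ν = ∞ := by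
  simp [genKL, h]

lemma exp_mul_klFun_add (t u v : ℝ) (ht : 0 ≤ t) :
    Real.exp (u - v) * klFun (t * (Real.exp (u - v))⁻¹) + t * u + 1
      = klFun t + t * v + Real.exp (u - v) := by
  rw [klFun_apply, klFun_apply]
  have hE := Real.exp_pos (u - v)
  rcases ht.eq_or_lt with rfl | ht
  · simp; ring
  · rw [Real.log_mul ht.ne' (by positivity), Real.log_inv, Real.log_exp]
    field_simp
    ring

/-- Tilting the reference measure changes the divergence by a linear functional of `μ` and a
change of mass. The identity is arranged so that all terms are non-negative; hence it needs no
integrability. -/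
lemma genKL_withDensity_exp (μ ν : Measure α) [IsFiniteMeasure μ] [SigmaFinite ν]
    {u v : α → ℝ} (hu : Measurable u) (hv : Measurable v) (hu0 : ∀ x, 0 ≤ u x)
    (hv0 : ∀ x, 0 ≤ v x) :
    genKL μ (ν.withDensity fun x => ENNReal.ofReal (Real.exp (u x - v x)))
        + ∫⁻ x, ENNReal.ofReal (u x) ∂μ + ν Set.univ
      = genKL μ ν + ∫⁻ x, ENNReal.ofReal (v x) ∂μ
        + ∫⁻ x, ENNReal.ofReal (Real.exp (u x - v x)) ∂ν := by
  set w : α → ℝ≥0∞ := fun x => ENNReal.ofReal (Real.exp (u x - v x)) with hw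
  have hwm : Measurable w := by fun_prop
  have hw0 : ∀ x, w x ≠ 0 := fun x => by simp [hw, Real.exp_pos]
  have hwt : ∀ x, w x ≠ ∞ := fun x => by simp [hw]
  by_cases hac : μ ≪ ν
  swap
  · have hac' : ¬ μ ≪ ν.withDensity w := fun h =>
      hac (h.trans (withDensity_absolutelyContinuous _ _))
    simp [genKL_of_not_ac hac, genKL_of_not_ac hac']
  have hac' : μ ≪ ν.withDensity w :=
    hac.trans (withDensity_absolutelyContinuous' hwm.aemeasurable (ae_of_all _ hw0))
  have hk' : Measurable fun x => ENNReal.ofReal (klFun (μ.rnDeriv (ν.withDensity w) x).toReal) :=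
    (measurable_klFun.comp (Measure.measurable_rnDeriv μ _).ennreal_toReal).ennreal_ofReal
  have hm : ∀ {a : α → ℝ}, Measurable a →
      Measurable fun x => μ.rnDeriv ν x * ENNReal.ofReal (a x) :=
    fun ha => (Measure.measurable_rnDeriv μ ν).mul ha.ennreal_ofReal
  rw [genKL_of_ac hac, genKL_of_ac hac', lintegral_withDensity_eq_lintegral_mul₀ hwm.aemeasurable
      hk'.aemeasurable,
    ← lintegral_rnDeriv_mul hac hu.ennreal_ofReal.aemeasurable,
    ← lintegral_rnDeriv_mul hac hv.ennreal_ofReal.aemeasurable, ← lintegral_one,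
    ← lintegral_add_right _ (hm hu),
    ← lintegral_add_right _ measurable_const,
    ← lintegral_add_right _ (hm hv),
    ← lintegral_add_right _ hwm]
  refine lintegral_congr_ae ?_
  filter_upwards [Measure.rnDeriv_withDensity_right μ ν hwm.aemeasurable (ae_of_all _ hw0)
    (ae_of_all _ hwt), Measure.rnDeriv_lt_top μ ν] with x hx hx'
  have ht := ENNReal.ofReal_toReal hx'.ne
  set t := (μ.rnDeriv ν x).toReal with ht_def
  have ht0 : 0 ≤ t := ENNReal.toReal_nonneg
  have hE := Real.exp_pos (u x - v x)
  have e1 : (μ.rnDeriv (ν.withDensity w) x).toReal = t * (Real.exp (u x - v x))⁻¹ := by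
    rw [hx, ENNReal.toReal_mul, ENNReal.toReal_inv, hw, ENNReal.toReal_ofReal hE.le, mul_comm]
  have k1 := klFun_nonneg (x := t * (Real.exp (u x - v x))⁻¹) (by positivity)
  have k2 := klFun_nonneg ht0
  rw [Pi.mul_apply, e1, ← ht, hw, ← ENNReal.ofReal_one]
  simp only
  rw [← ENNReal.ofReal_mul hE.le, ← ENNReal.ofReal_mul ht0, ← ENNReal.ofReal_mul ht0]
  have a1 := mul_nonneg hE.le k1
  have a2 := mul_nonneg ht0 (hu0 x)
  have a3 := mul_nonneg ht0 (hv0 x)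
  rw [← ENNReal.ofReal_add a1 a2, ← ENNReal.ofReal_add (by positivity) zero_le_one,
    ← ENNReal.ofReal_add k2 a3, ← ENNReal.ofReal_add (by positivity) hE.le,
    exp_mul_klFun_add _ _ _ ht0]

/-- A finite measure has infinite divergence from a measure of infinite mass. -/
lemma measure_univ_lt_top_of_genKL_ne_top {μ ν : Measure α} [IsFiniteMeasure μ] [SigmaFinite ν]
    (h : genKL μ ν ≠ ∞) : ν Set.univ < ∞ := by
  have hac : μ ≪ ν := by
    by_contra hac
    exact h (genKL_of_not_ac hac)
  rw [genKL_of_ac hac] at h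
  have key : ∫⁻ _, ENNReal.ofReal (1 / 2) ∂ν
      ≤ ∫⁻ x, ENNReal.ofReal (klFun (μ.rnDeriv ν x).toReal) ∂ν + ∫⁻ x, μ.rnDeriv ν x ∂ν := by
    rw [← lintegral_add_right _ (Measure.measurable_rnDeriv μ ν)]
    refine lintegral_mono_ae ?_
    filter_upwards [Measure.rnDeriv_lt_top μ ν] with x hx
    nth_rw 2 [← ENNReal.ofReal_toReal hx.ne]
    set t := (μ.rnDeriv ν x).toReal
    have ht0 : 0 ≤ t := ENNReal.toReal_nonneg
    rw [← ENNReal.ofReal_add (klFun_nonneg ht0) ht0]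
    refine ENNReal.ofReal_le_ofReal ?_
    rw [klFun_apply]
    rcases ht0.eq_or_lt with h0 | h0
    · rw [← h0]; norm_num
    · -- `log (2 t) ≥ 1 - 1 / (2 t)` gives `t log t ≥ t (1 - log 2) - 1 / 2 ≥ -1 / 2`
      have h1 := Real.one_sub_inv_le_log_of_pos (x := 2 * t) (by positivity)
      rw [Real.log_mul (by norm_num) h0.ne'] at h1
      have h2 := Real.log_two_lt_d9
      have h3 : t * (1 - (2 * t)⁻¹) = t - 1 / 2 := by field_simp
      nlinarith [mul_le_mul_of_nonneg_left h1 ht0]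
  rw [lintegral_const] at key
  by_contra hν
  rw [not_lt, top_le_iff] at hν
  rw [hν, ENNReal.mul_top (by simp), top_le_iff, ENNReal.add_eq_top] at key
  rcases key with key | key
  · exact h key
  · exact (Measure.lintegral_rnDeriv_lt_top μ ν).ne key

end Tilting

/-! ### Entropy minimization under linear constraints -/

open Filter Topology in
/-- Difference quotients of `s ↦ x ^ (1 - s)` at `0` recover `klFun`. -/
lemma tendsto_sub_rpow_div_klFun {x : ℝ} (hx : 0 ≤ x) :
    Tendsto (fun k : ℕ => (x - x ^ (1 - 1 / ((k : ℝ) + 1))) / (1 / ((k : ℝ) + 1)) - x + 1) atTop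
      (𝓝 (klFun x)) := by
  rcases hx.eq_or_lt with rfl | hx
  · refine (tendsto_congr' ?_).mpr (tendsto_const_nhds (x := klFun 0))
    filter_upwards [eventually_gt_atTop 0] with k hk
    have hk' : (0 : ℝ) < k := by exact_mod_cast hk
    rw [Real.zero_rpow]
    · simp [klFun_zero]
    · have : 1 / ((k : ℝ) + 1) < 1 := by rw [div_lt_one (by positivity)]; linarith
      linarith
  · have hd : HasDerivAt (fun s : ℝ => -(x ^ (1 - s))) (x * Real.log x) 0 := by
      have h := (((hasDerivAt_id (0 : ℝ)).const_sub 1).const_rpow hx).neg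
      exact h.congr_deriv (by simp [mul_comm])
    have hs : Tendsto (fun k : ℕ => 1 / ((k : ℝ) + 1)) atTop (𝓝[≠] 0) := by
      rw [tendsto_nhdsWithin_iff]
      exact ⟨tendsto_one_div_add_atTop_nhds_zero_nat, Eventually.of_forall fun k => by
        have : (0 : ℝ) < 1 / ((k : ℝ) + 1) := by positivity
        exact this.ne'⟩
    have h := ((hd.tendsto_slope_zero.comp hs).sub_const x).add_const 1
    have e : klFun x = x * Real.log x - x + 1 := by rw [klFun_apply]; ring
    rw [e]
    refine h.congr fun k => ?_
    simp only [Function.comp_apply, smul_eq_mul, zero_add, sub_zero, Real.rpow_one]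
    rw [div_eq_inv_mul]
    ring

lemma sub_rpow_div_nonneg {x s : ℝ} (hx : 0 ≤ x) (hs : 0 < s) (hs1 : s ≤ 1) :
    0 ≤ (x - x ^ (1 - s)) / s - x + 1 := by
  have h := Real.geom_mean_le_arith_mean2_weighted (sub_nonneg.2 hs1) hs.le hx zero_le_one
    (by ring)
  rw [Real.one_rpow, mul_one, mul_one] at h
  have : x - 1 ≤ (x - x ^ (1 - s)) / s := by
    rw [le_div_iff₀ hs]; nlinarith
  linarith

/-- A linear functional squeezed below the convex function `c ↦ (exp c - 1) * b`, with which it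
agrees at `0`, is its tangent. -/
lemma eq_of_forall_mul_le_exp_sub_one_mul {a b : ℝ}
    (h : ∀ c : ℝ, c * a ≤ (Real.exp c - 1) * b) : a = b := by
  have hmin : IsLocalMin (fun c : ℝ => (Real.exp c - 1) * b - c * a) 0 :=
    Filter.Eventually.of_forall fun c => by simpa using h c
  have hd : HasDerivAt (fun c : ℝ => (Real.exp c - 1) * b - c * a) (b - a) 0 := by
    have := (((Real.hasDerivAt_exp 0).sub_const 1).mul_const b).sub
      ((hasDerivAt_id (0 : ℝ)).mul_const a)
    exact this.congr_deriv (by simp)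
  linarith [hmin.hasDerivAt_eq_zero hd]

section LinearConstraints

variable {Ω : Type*} [MeasurableSpace Ω] {ν : Measure Ω}

lemma setIntegral_sq_eq_norm_restrict_sq (B : Set Ω) (g : Lp ℝ 2 ν) :
    ∫ ω in B, g ω ^ 2 ∂ν = ‖LpToLpRestrictCLM Ω ℝ ℝ ν 2 B g‖ ^ 2 := by
  rw [← real_inner_self_eq_norm_sq, L2.inner_def]
  refine integral_congr_ae ?_
  filter_upwards [LpToLpRestrictCLM_coeFn ℝ B g] with ω hω
  rw [hω]
  simp [sq]

open Filter Topology in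
/-- Duality for entropy minimization under linear constraints, in the form of an existence theorem.
Let `v ↦ T v` be a linear family of bounded measurable functions and `ℓ` a linear functional. If the
dual values `ℓ v - ∫ exp (T v) dν + 1` are at most `S`, then some `Q ≪ ν` with divergence at most
`S` from `ν` satisfies the constraints `Q B = ℓ v` for all `v` such that `T v` is the indicator
function of `B`. The measure `Q` is the limit of `exp (T v) ν` along a maximizing sequence. -/
theorem exists_measure_genKL_le [IsProbabilityMeasure ν] {V : Type*} [AddCommGroup V] [Module ℝ V]
    (T : V →ₗ[ℝ] (Ω → ℝ)) (ℓ : V →ₗ[ℝ] ℝ) (hTm : ∀ v, Measurable (T v))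
    (hTb : ∀ v, ∃ C, ∀ ω, |T v ω| ≤ C) (S : ℝ)
    (hS : ∀ v, ℓ v - ∫ ω, Real.exp (T v ω) ∂ν + 1 ≤ S) :
    ∃ Q : Measure Ω, IsFiniteMeasure Q ∧
      (∀ (v : V) (B : Set Ω), MeasurableSet B → T v = B.indicator 1 →
        Q B = ENNReal.ofReal (ℓ v)) ∧
      genKL Q ν ≤ ENNReal.ofReal S := by
  set J : V → ℝ := fun v => ℓ v - ∫ ω, Real.exp (T v ω) ∂ν + 1 with hJ
  have hbdd : BddAbove (Set.range J) := ⟨S, by rintro _ ⟨v, rfl⟩; exact hS v⟩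
  set S' := sSup (Set.range J) with hS'
  have hJS : ∀ v, J v ≤ S' := fun v => le_csSup hbdd ⟨v, rfl⟩
  have hSS : S' ≤ S := csSup_le (Set.range_nonempty J) (by rintro _ ⟨v, rfl⟩; exact hS v)
  have hint : ∀ (c : ℝ) (v : V), Integrable (fun ω => Real.exp (c * T v ω)) ν := by
    intro c v
    obtain ⟨C, hC⟩ := hTb v
    refine Integrable.of_bound (C := Real.exp (|c| * C))
      (((hTm v).const_mul c).exp).aestronglyMeasurable (ae_of_all _ fun ω => ?_)
    rw [Real.norm_eq_abs, Real.abs_exp, Real.exp_le_exp]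
    calc c * T v ω ≤ |c * T v ω| := le_abs_self _
      _ = |c| * |T v ω| := abs_mul _ _
      _ ≤ |c| * C := by gcongr; exact hC ω
  have hint1 : ∀ v : V, Integrable (fun ω => Real.exp (T v ω)) ν := fun v => by
    simpa using hint 1 v
  have hLp : ∀ v : V, MemLp (fun ω => Real.exp (T v ω / 2)) 2 ν := by
    intro v
    rw [memLp_two_iff_integrable_sq ((hTm v).div_const 2).exp.aestronglyMeasurable]
    refine (hint1 v).congr (ae_of_all _ fun ω => ?_)
    simp only
    rw [← Real.exp_nat_mul]; congr 1; push_cast; ring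
  -- The defect of concavity of `J` is a squared Hellinger distance.
  have hpar : ∀ v w : V, ‖(hLp v).toLp - (hLp w).toLp‖ ^ 2 ≤ (S' - J v) + (S' - J w) := by
    intro v w
    have hmid := hJS ((1 / 2 : ℝ) • (v + w))
    have e1 : ‖(hLp v).toLp - (hLp w).toLp‖ ^ 2 = ∫ ω, Real.exp (T v ω) ∂ν
        + ∫ ω, Real.exp (T w ω) ∂ν - 2 * ∫ ω, Real.exp (T ((1 / 2 : ℝ) • (v + w)) ω) ∂ν := by
      have hadd : Integrable (fun ω => Real.exp (T v ω) + Real.exp (T w ω)) ν :=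
        (hint1 v).add (hint1 w)
      rw [← integral_const_mul, ← integral_add (hint1 v) (hint1 w),
        ← integral_sub hadd ((hint1 _).const_mul 2),
        ← real_inner_self_eq_norm_sq, L2.inner_def]
      refine integral_congr_ae ?_
      filter_upwards [Lp.coeFn_sub (hLp v).toLp (hLp w).toLp, (hLp v).coeFn_toLp,
        (hLp w).coeFn_toLp] with ω h1 h2 h3
      rw [h1, Pi.sub_apply, h2, h3]
      have a1 : Real.exp (T v ω) = Real.exp (T v ω / 2) * Real.exp (T v ω / 2) := by
        rw [← Real.exp_add]; congr 1; ring
      have a2 : Real.exp (T w ω) = Real.exp (T w ω / 2) * Real.exp (T w ω / 2) := by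
        rw [← Real.exp_add]; congr 1; ring
      have a3 : Real.exp (T ((1 / 2 : ℝ) • (v + w)) ω)
          = Real.exp (T v ω / 2) * Real.exp (T w ω / 2) := by
        rw [← Real.exp_add, map_smul, map_add]; congr 1
        simp only [Pi.smul_apply, Pi.add_apply, smul_eq_mul]; ring
      rw [a1, a2, a3]
      simp only [inner, star_trivial, RCLike.re_to_real]
      ring
    rw [e1]
    simp only [hJ, map_smul, map_add, smul_eq_mul] at hmid ⊢
    linarith
  obtain ⟨a, ha_mono, ha_lim, ha_mem⟩ := exists_seq_tendsto_sSup (Set.range_nonempty J) hbdd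
  choose v hv using ha_mem
  have hJlim : Tendsto (fun n => J (v n)) atTop (𝓝 S') := by simpa only [hv] using ha_lim
  have hcauchy : CauchySeq fun n => (hLp (v n)).toLp := by
    refine cauchySeq_of_le_tendsto_0 (fun N => Real.sqrt ((S' - a N) + (S' - a N))) ?_ ?_
    · intro n m N hn hm
      rw [dist_eq_norm]
      refine Real.le_sqrt_of_sq_le ((hpar _ _).trans ?_)
      rw [hv, hv]
      linarith [ha_mono hn, ha_mono hm]
    · have := ((ha_lim.const_sub S').add (ha_lim.const_sub S')).sqrt
      simpa [hS'] using this
  obtain ⟨h, hh⟩ := cauchySeq_tendsto_of_complete hcauchy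
  have hhm : Measurable h := (Lp.stronglyMeasurable h).measurable
  have hhint : Integrable (fun ω => h ω ^ 2) ν := (Lp.memLp h).integrable_sq
  set q : Ω → ℝ≥0∞ := fun ω => ENNReal.ofReal (h ω ^ 2) with hq
  have hqm : Measurable q := (hhm.pow_const 2).ennreal_ofReal
  have hfin : IsFiniteMeasure (ν.withDensity q) :=
    isFiniteMeasure_withDensity_ofReal hhint.2
  refine ⟨ν.withDensity q, hfin, ?_, ?_⟩
  · intro w B hB hw
    have hconv : Tendsto (fun n => ∫ ω in B, Real.exp (T (v n) ω) ∂ν) atTop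
        (𝓝 (∫ ω in B, h ω ^ 2 ∂ν)) := by
      have h1 := ((((LpToLpRestrictCLM Ω ℝ ℝ ν 2 B).continuous.tendsto h).comp hh).norm).pow 2
      rw [← setIntegral_sq_eq_norm_restrict_sq] at h1
      refine h1.congr fun n => ?_
      simp only [Function.comp_apply]
      rw [← setIntegral_sq_eq_norm_restrict_sq]
      refine integral_congr_ae (ae_restrict_of_ae ?_)
      filter_upwards [(hLp (v n)).coeFn_toLp] with ω hω
      rw [hω, ← Real.exp_nat_mul]; congr 1; push_cast; ring
    -- Perturbing the maximizing sequence in the direction `w` yields the constraint.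
    have hkey : ∀ c : ℝ, c * ℓ w ≤ (Real.exp c - 1) * ∫ ω in B, h ω ^ 2 ∂ν := by
      intro c
      have h1 : ∀ n, J (v n) + c * ℓ w
          - (Real.exp c - 1) * ∫ ω in B, Real.exp (T (v n) ω) ∂ν ≤ S' := by
        intro n
        have h2 := hJS (v n + c • w)
        have e : ∫ ω, Real.exp (T (v n + c • w) ω) ∂ν = ∫ ω, Real.exp (T (v n) ω) ∂ν
            + (Real.exp c - 1) * ∫ ω in B, Real.exp (T (v n) ω) ∂ν := by
          rw [← integral_indicator hB, ← integral_const_mul,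
            ← integral_add (hint1 _) (((hint1 _).indicator hB).const_mul _)]
          refine integral_congr_ae (ae_of_all _ fun ω => ?_)
          simp only [map_add, map_smul, hw, Pi.add_apply, Pi.smul_apply, smul_eq_mul]
          by_cases hω : ω ∈ B
          · simp only [Set.indicator_of_mem hω, Pi.one_apply, Real.exp_add]; ring_nf
          · simp [Set.indicator_of_notMem hω]
        simp only [hJ] at h2 ⊢
        rw [e, map_add, map_smul, smul_eq_mul] at h2
        linarith
      have h3 := le_of_tendsto' ((hJlim.add_const (c * ℓ w)).sub
        (hconv.const_mul (Real.exp c - 1))) h1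
      linarith
    rw [withDensity_apply _ hB, eq_of_forall_mul_le_exp_sub_one_mul hkey,
      ofReal_integral_eq_lintegral_ofReal hhint.integrableOn
        (ae_of_all _ fun ω => by positivity)]
  · have hac : ν.withDensity q ≪ ν := withDensity_absolutelyContinuous _ _
    refine le_trans ?_ (ENNReal.ofReal_le_ofReal hSS)
    rw [genKL_of_ac hac]
    have hcongr : ∫⁻ ω, ENNReal.ofReal (klFun ((ν.withDensity q).rnDeriv ν ω).toReal) ∂ν
        = ∫⁻ ω, ENNReal.ofReal (klFun (h ω ^ 2)) ∂ν := by
      refine lintegral_congr_ae ?_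
      filter_upwards [Measure.rnDeriv_withDensity ν hqm] with ω hω
      rw [hω, hq, ENNReal.toReal_ofReal (by positivity)]
    rw [hcongr]
    obtain ⟨ns, hns, hae⟩ := (tendstoInMeasure_of_tendsto_Lp hh).exists_seq_tendsto_ae
    -- Shrinking the maximizing sequence by the factor `1 - s` controls its expectation under `Q`.
    have hs_bound : ∀ s : ℝ, 0 < s → s < 1 →
        ∫⁻ ω, ENNReal.ofReal ((h ω ^ 2 - (h ω ^ 2) ^ (1 - s)) / s - h ω ^ 2 + 1) ∂ν
          ≤ ENNReal.ofReal S' := by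
      intro s hs hs1
      have hF : Continuous fun x : ℝ => (x - x ^ (1 - s)) / s - x + 1 := by
        have : Continuous fun x : ℝ => x ^ (1 - s) :=
          Real.continuous_rpow_const (by linarith)
        fun_prop
      have hval : ∀ n, ∫⁻ ω, ENNReal.ofReal ((Real.exp (T (v n) ω)
            - Real.exp (T (v n) ω) ^ (1 - s)) / s - Real.exp (T (v n) ω) + 1) ∂ν
          ≤ ENNReal.ofReal (J (v n) + (S' - J (v n)) / s) := by
        intro n
        have hi : Integrable (fun ω => Real.exp (T (v n) ω) ^ (1 - s)) ν := by
          refine (hint (1 - s) (v n)).congr (ae_of_all _ fun ω => ?_)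
          simp only
          rw [← Real.exp_mul, mul_comm]
        have hi1 : Integrable (fun ω => Real.exp (T (v n) ω) - Real.exp (T (v n) ω) ^ (1 - s)) ν :=
          (hint1 (v n)).sub hi
        have hi2 : Integrable (fun ω => (Real.exp (T (v n) ω) - Real.exp (T (v n) ω) ^ (1 - s)) / s
            - Real.exp (T (v n) ω)) ν := (hi1.div_const s).sub (hint1 (v n))
        have hi3 : Integrable (fun ω => (Real.exp (T (v n) ω) - Real.exp (T (v n) ω) ^ (1 - s)) / s
            - Real.exp (T (v n) ω) + 1) ν := hi2.add (integrable_const (1 : ℝ))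
        rw [← ofReal_integral_eq_lintegral_ofReal hi3 (ae_of_all _ fun ω =>
          sub_rpow_div_nonneg (Real.exp_pos _).le hs hs1.le)]
        refine ENNReal.ofReal_le_ofReal ?_
        have h2 := hJS ((1 - s) • v n)
        have e : ∫ ω, Real.exp (T (v n) ω) ^ (1 - s) ∂ν
            = ∫ ω, Real.exp (T ((1 - s) • v n) ω) ∂ν := by
          refine integral_congr_ae (ae_of_all _ fun ω => ?_)
          simp only [map_smul, Pi.smul_apply, smul_eq_mul]
          rw [← Real.exp_mul, mul_comm]
        have e2 : ∫ ω, ((Real.exp (T (v n) ω) - Real.exp (T (v n) ω) ^ (1 - s)) / s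
              - Real.exp (T (v n) ω) + 1) ∂ν
            = (∫ ω, Real.exp (T (v n) ω) ∂ν - ∫ ω, Real.exp (T ((1 - s) • v n) ω) ∂ν) / s
              - ∫ ω, Real.exp (T (v n) ω) ∂ν + 1 := by
          rw [integral_add hi2 (integrable_const _), integral_sub (hi1.div_const s) (hint1 (v n)),
            integral_div, integral_sub (hint1 (v n)) hi, e]
          simp
        refine e2.trans_le ?_
        simp only [hJ, map_smul, smul_eq_mul] at h2 ⊢
        rw [← sub_nonneg] at h2 ⊢
        refine (div_nonneg h2 hs.le).trans_eq ?_
        field_simp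
        ring
      have hfatou : ∫⁻ ω, ENNReal.ofReal ((h ω ^ 2 - (h ω ^ 2) ^ (1 - s)) / s - h ω ^ 2 + 1) ∂ν
          ≤ liminf (fun n => ∫⁻ ω, ENNReal.ofReal ((Real.exp (T (v (ns n)) ω)
            - Real.exp (T (v (ns n)) ω) ^ (1 - s)) / s - Real.exp (T (v (ns n)) ω) + 1) ∂ν)
            atTop := by
        refine le_trans (lintegral_mono_ae ?_) (lintegral_liminf_le fun n => ?_)
        · have hall : ∀ᵐ ω ∂ν, ∀ n, ((hLp (v (ns n))).toLp : Ω → ℝ) ω = Real.exp (T (v (ns n)) ω / 2) :=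
            ae_all_iff.2 fun n => (hLp (v (ns n))).coeFn_toLp
          filter_upwards [hae, hall] with ω hω hω'
          have h1 : Tendsto (fun n => Real.exp (T (v (ns n)) ω)) atTop (𝓝 (h ω ^ 2)) := by
            refine (hω.pow 2).congr fun n => ?_
            rw [hω', ← Real.exp_nat_mul]; congr 1; push_cast; ring
          exact (ENNReal.tendsto_ofReal ((hF.tendsto _).comp h1)).liminf_eq.ge
        · exact (hF.measurable.comp (hTm _).exp).ennreal_ofReal
      refine hfatou.trans ?_
      have hlim : Tendsto (fun n => ENNReal.ofReal (J (v (ns n)) + (S' - J (v (ns n))) / s)) atTop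
          (𝓝 (ENNReal.ofReal S')) := by
        have h1 := hJlim.comp hns.tendsto_atTop
        have h2 := h1.add ((h1.const_sub S').div_const s)
        simp only [sub_self, zero_div, add_zero] at h2
        exact ENNReal.tendsto_ofReal h2
      rw [← hlim.liminf_eq]
      exact liminf_le_liminf (Eventually.of_forall fun n => hval (ns n))
    have hfatou : ∫⁻ ω, ENNReal.ofReal (klFun (h ω ^ 2)) ∂ν
        ≤ liminf (fun k : ℕ => ∫⁻ ω, ENNReal.ofReal ((h ω ^ 2
          - (h ω ^ 2) ^ (1 - 1 / ((k : ℝ) + 1))) / (1 / ((k : ℝ) + 1)) - h ω ^ 2 + 1) ∂ν)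
          atTop := by
      refine le_trans (lintegral_mono fun ω => ?_) (lintegral_liminf_le fun k => ?_)
      · exact (ENNReal.tendsto_ofReal
          (tendsto_sub_rpow_div_klFun (sq_nonneg (h ω)))).liminf_eq.ge
      · fun_prop
    refine hfatou.trans (liminf_le_of_frequently_le' (Eventually.frequently ?_))
    filter_upwards [eventually_gt_atTop 0] with k hk
    have hk' : (0 : ℝ) < k := by exact_mod_cast hk
    refine hs_bound _ (by positivity) ?_
    rw [div_lt_one (by positivity)]
    linarith

end LinearConstraints

/-! ### Strong duality for couplings -/

section Couplings

variable {X Y : Type*} [MeasurableSpace X] [MeasurableSpace Y]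

lemma MeasureTheory.SimpleFunc.exists_forall_abs_le (φ : SimpleFunc X ℝ) : ∃ C, ∀ x, |φ x| ≤ C := by
  obtain ⟨C, hC⟩ := (φ.finite_range.image abs).bddAbove
  exact ⟨C, fun x => hC ⟨φ x, ⟨x, rfl⟩, rfl⟩⟩

/-- Strong duality for entropy minimization over couplings: a bound on the dual values of simple
potentials is attained by the divergence of some coupling. -/
theorem exists_coupling_genKL_le (p₀ : Measure X) (p₁ : Measure Y) (ν : Measure (X × Y))
    [IsProbabilityMeasure p₀] [IsProbabilityMeasure p₁] [IsProbabilityMeasure ν] (S : ℝ)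
    (hS : ∀ (φ : SimpleFunc X ℝ) (ψ : SimpleFunc Y ℝ),
      ∫ x, φ x ∂p₀ + ∫ y, ψ y ∂p₁ - ∫ z, Real.exp (φ z.1 + ψ z.2) ∂ν + 1 ≤ S) :
    ∃ Q : Measure (X × Y), IsFiniteMeasure Q ∧ Q.fst = p₀ ∧ Q.snd = p₁ ∧
      genKL Q ν ≤ ENNReal.ofReal S := by
  have hi₀ : ∀ φ : SimpleFunc X ℝ, Integrable φ p₀ := fun φ => φ.integrable_of_isFiniteMeasure
  have hi₁ : ∀ ψ : SimpleFunc Y ℝ, Integrable ψ p₁ := fun ψ => ψ.integrable_of_isFiniteMeasure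
  let T : (SimpleFunc X ℝ × SimpleFunc Y ℝ) →ₗ[ℝ] (X × Y → ℝ) :=
    { toFun := fun v z => v.1 z.1 + v.2 z.2
      map_add' := fun v w => by
        funext z
        simp only [Prod.fst_add, Prod.snd_add, SimpleFunc.coe_add, Pi.add_apply]
        ring
      map_smul' := fun c v => by
        funext z
        simp [mul_add] }
  let ℓ : (SimpleFunc X ℝ × SimpleFunc Y ℝ) →ₗ[ℝ] ℝ :=
    { toFun := fun v => ∫ x, v.1 x ∂p₀ + ∫ y, v.2 y ∂p₁
      map_add' := fun v w => by
        simp only [Prod.fst_add, Prod.snd_add, SimpleFunc.coe_add, Pi.add_apply]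
        rw [integral_add (hi₀ _) (hi₀ _), integral_add (hi₁ _) (hi₁ _)]
        ring
      map_smul' := fun c v => by
        simp [integral_const_mul, mul_add] }
  obtain ⟨Q, hQ, hmarg, hKL⟩ := exists_measure_genKL_le (ν := ν) T ℓ
    (fun v => (v.1.measurable.comp measurable_fst).add (v.2.measurable.comp measurable_snd))
    (fun v => by
      obtain ⟨C₀, h₀⟩ := SimpleFunc.exists_forall_abs_le v.1
      obtain ⟨C₁, h₁⟩ := SimpleFunc.exists_forall_abs_le v.2
      exact ⟨C₀ + C₁, fun z => (abs_add_le _ _).trans (add_le_add (h₀ _) (h₁ _))⟩)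
    S (fun v => hS v.1 v.2)
  refine ⟨Q, hQ, ?_, ?_, hKL⟩
  · ext A hA
    rw [Measure.fst_apply hA, hmarg (SimpleFunc.piecewise A hA (SimpleFunc.const X 1) 0, 0)
      (Prod.fst ⁻¹' A) (measurable_fst hA)]
    · simp [ℓ, SimpleFunc.coe_piecewise, Set.piecewise_eq_indicator, integral_indicator, hA]
    · funext z
      by_cases hz : z.1 ∈ A <;> simp [T, hz, SimpleFunc.piecewise_apply]
  · ext A hA
    rw [Measure.snd_apply hA, hmarg (0, SimpleFunc.piecewise A hA (SimpleFunc.const Y 1) 0)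
      (Prod.snd ⁻¹' A) (measurable_snd hA)]
    · simp [ℓ, SimpleFunc.coe_piecewise, Set.piecewise_eq_indicator, integral_indicator, hA]
    · funext z
      by_cases hz : z.2 ∈ A <;> simp [T, hz, SimpleFunc.piecewise_apply]

end Couplings

/-! ### Gaussian transition densities -/

/-- Density of the Gaussian measure with mean `x` and covariance `ε • 1`. -/
noncomputable def heatDensity {D : ℕ} (ε : ℝ) (x y : Euc D) : ℝ :=
  (2 * Real.pi * ε) ^ (-(D : ℝ) / 2) * Real.exp (-(‖x - y‖ ^ 2 / 2) / ε)

section Gaussian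

variable {D : ℕ} {ε : ℝ}

lemma heatDensity_pos (hε : 0 < ε) (x y : Euc D) : 0 < heatDensity ε x y := by
  unfold heatDensity; positivity

@[fun_prop]
lemma measurable_heatDensity : Measurable fun z : Euc D × Euc D => heatDensity ε z.1 z.2 := by
  unfold heatDensity; fun_prop

lemma measurable_heatDensity_right (x : Euc D) : Measurable fun y => heatDensity ε x y := by
  unfold heatDensity; fun_prop

lemma heatDensity_zero_eq (y : Euc D) : heatDensity ε 0 y
    = (2 * Real.pi * ε) ^ (-(D : ℝ) / 2) * Real.exp (-(1 / (2 * ε)) * ‖y‖ ^ 2) := by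
  unfold heatDensity
  rw [zero_sub, norm_neg]
  congr 2
  ring

lemma integrable_exp_neg_mul_sq_norm {b : ℝ} (hb : 0 < b) :
    Integrable fun y : Euc D => Real.exp (-b * ‖y‖ ^ 2) := by
  have h := (GaussianFourier.integrable_cexp_neg_mul_sq_norm_add (V := Euc D) (b := b) (by simpa using hb) 0 0).norm
  refine h.congr (ae_of_all _ fun y => ?_)
  simp only [zero_mul, add_zero]
  rw [Complex.norm_exp]
  congr 1
  norm_cast

lemma integrable_heatDensity_zero (hε : 0 < ε) : Integrable fun y : Euc D => heatDensity ε 0 y := by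
  simp only [heatDensity_zero_eq]
  exact (integrable_exp_neg_mul_sq_norm (by positivity)).const_mul _

lemma map_smul_stdGaussian (hε : 0 < ε) :
    (stdGaussian (Euc D)).map (fun z => Real.sqrt ε • z)
      = (volume : Measure (Euc D)).withDensity fun y => ENNReal.ofReal (heatDensity ε 0 y) := by
  have : IsFiniteMeasure
      ((volume : Measure (Euc D)).withDensity fun y => ENNReal.ofReal (heatDensity ε 0 y)) :=
    isFiniteMeasure_withDensity_ofReal (integrable_heatDensity_zero hε).2
  have : IsProbabilityMeasure ((stdGaussian (Euc D)).map (fun z => Real.sqrt ε • z)) :=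
    Measure.isProbabilityMeasure_map (by fun_prop)
  refine Measure.ext_of_charFun ?_
  ext t
  have hm : Measurable fun y : Euc D => heatDensity ε 0 y :=
    measurable_heatDensity_right 0
  rw [charFun_map_smul, charFun_stdGaussian, charFun_apply,
    integral_withDensity_eq_integral_toReal_smul hm.ennreal_ofReal (ae_of_all _ fun y => by simp)]
  have hb : 0 < ((1 / (2 * ε) : ℝ) : ℂ).re := by rw [Complex.ofReal_re]; positivity
  have hG := GaussianFourier.integral_cexp_neg_mul_sq_norm_add (V := Euc D) hb Complex.I t
  have hcong : ∀ y : Euc D, (ENNReal.ofReal (heatDensity ε 0 y)).toReal •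
      Complex.exp ((inner ℝ y t : ℝ) * Complex.I)
      = (((2 * Real.pi * ε) ^ (-(D : ℝ) / 2) : ℝ) : ℂ) * Complex.exp
        (-((1 / (2 * ε) : ℝ) : ℂ) * (‖y‖ : ℂ) ^ 2 + Complex.I * ((inner ℝ t y : ℝ) : ℂ)) := by
    intro y
    rw [ENNReal.toReal_ofReal (heatDensity_pos hε _ _).le, heatDensity_zero_eq, Complex.real_smul,
      Complex.exp_add, real_inner_comm]
    push_cast
    ring_nf
  simp only [hcong]
  rw [integral_const_mul, hG]
  have hpi : (Real.pi : ℂ) / ((1 / (2 * ε) : ℝ) : ℂ) = ((2 * Real.pi * ε : ℝ) : ℂ) := by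
    have : (ε : ℂ) ≠ 0 := by exact_mod_cast hε.ne'
    push_cast; field_simp
  have hcp : ((2 * Real.pi * ε : ℝ) : ℂ) ^ ((Module.finrank ℝ (Euc D) : ℂ) / 2)
      = (((2 * Real.pi * ε) ^ ((D : ℝ) / 2) : ℝ) : ℂ) := by
    rw [Complex.ofReal_cpow (by positivity)]
    simp
  rw [hpi, hcp, ← mul_assoc, ← Complex.ofReal_mul, ← Real.rpow_add (by positivity)]
  have h0 : -(D : ℝ) / 2 + (D : ℝ) / 2 = 0 := by ring
  rw [h0, Real.rpow_zero, Complex.ofReal_one, one_mul, norm_smul, ← Complex.ofReal_pow, mul_pow,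
    Real.norm_eq_abs, sq_abs, Real.sq_sqrt hε.le]
  congr 1
  have : (ε : ℂ) ≠ 0 := by exact_mod_cast hε.ne'
  push_cast
  rw [Complex.I_sq]
  field_simp
  norm_num

/-- The law of `x + √ε z` for a standard Gaussian vector `z` has density `heatDensity ε x`. -/
lemma lintegral_stdGaussian_comp_add_smul (hε : 0 < ε) (x : Euc D) {F : Euc D → ℝ≥0∞}
    (hF : Measurable F) :
    ∫⁻ z, F (x + Real.sqrt ε • z) ∂(stdGaussian (Euc D))
      = ∫⁻ y, ENNReal.ofReal (heatDensity ε x y) * F y := by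
  have hm : Measurable fun y : Euc D => heatDensity ε 0 y :=
    measurable_heatDensity_right 0
  have hF' : Measurable fun y => F (x + y) := hF.comp (measurable_const_add x)
  have h1 : ∫⁻ z, F (x + Real.sqrt ε • z) ∂(stdGaussian (Euc D))
      = ∫⁻ y, F (x + y) ∂((stdGaussian (Euc D)).map (fun z => Real.sqrt ε • z)) :=
    (lintegral_map hF' (by fun_prop)).symm
  have h2 := lintegral_add_left_eq_self (μ := (volume : Measure (Euc D)))
    (fun y => ENNReal.ofReal (heatDensity ε x y) * F y) x
  rw [h1, map_smul_stdGaussian hε,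
    lintegral_withDensity_eq_lintegral_mul _ hm.ennreal_ofReal hF', ← h2]
  refine lintegral_congr fun y => ?_
  simp only [Pi.mul_apply, heatDensity, zero_sub, norm_neg, sub_add_cancel_left]

/-- The Gaussian transition kernel `x ↦ N(x, ε • 1)`. -/
noncomputable def heatKernel (D : ℕ) (ε : ℝ) : Kernel (Euc D) (Euc D) :=
  (Kernel.const (Euc D) (volume : Measure (Euc D))).withDensity
    fun x y => ENNReal.ofReal (heatDensity ε x y)

lemma measurable_uncurry_ofReal_heatDensity :
    Measurable (Function.uncurry fun x y : Euc D => ENNReal.ofReal (heatDensity ε x y)) :=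
  measurable_heatDensity.ennreal_ofReal

lemma heatKernel_apply (x : Euc D) : heatKernel D ε x
    = volume.withDensity fun y => ENNReal.ofReal (heatDensity ε x y) := by
  rw [heatKernel, Kernel.withDensity_apply _ measurable_uncurry_ofReal_heatDensity,
    Kernel.const_apply]

lemma measurable_ofReal_heatDensity_right (x : Euc D) :
    Measurable fun y => ENNReal.ofReal (heatDensity ε x y) :=
  (measurable_heatDensity_right x).ennreal_ofReal

lemma lintegral_heatKernel (x : Euc D) {F : Euc D → ℝ≥0∞} (hF : Measurable F) :
    ∫⁻ y, F y ∂(heatKernel D ε x) = ∫⁻ y, ENNReal.ofReal (heatDensity ε x y) * F y := by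
  rw [heatKernel_apply, lintegral_withDensity_eq_lintegral_mul _
    (measurable_ofReal_heatDensity_right x) hF]
  rfl

lemma isMarkovKernel_heatKernel (hε : 0 < ε) : IsMarkovKernel (heatKernel D ε) := by
  refine ⟨fun x => ⟨?_⟩⟩
  rw [← lintegral_one, lintegral_heatKernel x measurable_const,
    ← lintegral_stdGaussian_comp_add_smul hε x measurable_const]
  simp

lemma volume_absolutelyContinuous_heatKernel (hε : 0 < ε) (x : Euc D) :
    volume ≪ heatKernel D ε x := by
  rw [heatKernel_apply]
  exact withDensity_absolutelyContinuous' (measurable_ofReal_heatDensity_right x).aemeasurable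
    (ae_of_all _ fun y => by simpa using heatDensity_pos hε x y)

lemma heatKernel_absolutelyContinuous (x : Euc D) : heatKernel D ε x ≪ volume := by
  rw [heatKernel_apply]
  exact withDensity_absolutelyContinuous _ _

end Gaussian

/-! ### Chain rule for the divergence -/

section ChainRule

variable {X Y : Type*} [MeasurableSpace X] [MeasurableSpace Y]
  [MeasurableSpace.CountableOrCountablyGenerated X Y]

lemma ProbabilityTheory.Kernel.genKL_apply_of_ac (κ η : Kernel X Y) [IsFiniteKernel κ]
    [IsFiniteKernel η] {x : X} (h : κ x ≪ η x) :
    genKL (κ x) (η x) = ∫⁻ y, ENNReal.ofReal (klFun (Kernel.rnDeriv κ η x y).toReal) ∂(η x) := by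
  rw [genKL_of_ac h]
  refine lintegral_congr_ae ?_
  filter_upwards [Kernel.rnDeriv_eq_rnDeriv_measure (κ := κ) (η := η) (a := x)] with y hy
  rw [hy]

lemma ProbabilityTheory.Kernel.measurable_genKL (κ η : Kernel X Y) [IsFiniteKernel κ]
    [IsFiniteKernel η] : Measurable fun x => genKL (κ x) (η x) := by
  classical
  have h : (fun x => genKL (κ x) (η x)) = fun x => if κ x ≪ η x then
      ∫⁻ y, ENNReal.ofReal (klFun (Kernel.rnDeriv κ η x y).toReal) ∂(η x) else ∞ := by
    funext x
    split_ifs with hx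
    · exact Kernel.genKL_apply_of_ac κ η hx
    · exact genKL_of_not_ac hx
  rw [h]
  refine Measurable.ite (Kernel.measurableSet_absolutelyContinuous κ η) ?_ measurable_const
  refine Measurable.lintegral_kernel_prod_right (κ := η) ?_
  exact (measurable_klFun.comp (Kernel.measurable_rnDeriv κ η).ennreal_toReal).ennreal_ofReal

/-- Chain rule: measures with the same first marginal have as divergence the mean divergence of
their conditional laws. -/
lemma genKL_compProd (μ : Measure X) [IsFiniteMeasure μ] (κ η : Kernel X Y) [IsFiniteKernel κ]
    [IsFiniteKernel η] : genKL (μ ⊗ₘ κ) (μ ⊗ₘ η) = ∫⁻ x, genKL (κ x) (η x) ∂μ := by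
  by_cases hac : μ ⊗ₘ κ ≪ μ ⊗ₘ η
  · have hac' := Measure.absolutelyContinuous_compProd_right_iff.1 hac
    have ht : Measurable (Function.uncurry fun x y => Kernel.rnDeriv κ η x y) :=
      Kernel.measurable_rnDeriv κ η
    have hγ : μ ⊗ₘ κ = (μ ⊗ₘ η).withDensity fun z => Kernel.rnDeriv κ η z.1 z.2 := by
      rw [← Measure.compProd_withDensity ht]
      refine Measure.compProd_congr ?_
      filter_upwards [hac'] with x hx
      exact (Kernel.withDensity_rnDeriv_eq hx).symm
    have hd : (μ ⊗ₘ κ).rnDeriv (μ ⊗ₘ η) =ᵐ[μ ⊗ₘ η] fun z => Kernel.rnDeriv κ η z.1 z.2 := by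
      rw [hγ]
      exact Measure.rnDeriv_withDensity _ ht
    rw [genKL_of_ac hac]
    calc ∫⁻ z, ENNReal.ofReal (klFun ((μ ⊗ₘ κ).rnDeriv (μ ⊗ₘ η) z).toReal) ∂(μ ⊗ₘ η)
        = ∫⁻ z, ENNReal.ofReal (klFun (Kernel.rnDeriv κ η z.1 z.2).toReal) ∂(μ ⊗ₘ η) := by
          refine lintegral_congr_ae ?_
          filter_upwards [hd] with z hz
          rw [hz]
      _ = ∫⁻ x, ∫⁻ y, ENNReal.ofReal (klFun (Kernel.rnDeriv κ η x y).toReal) ∂(η x) ∂μ :=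
          Measure.lintegral_compProd
            (measurable_klFun.comp (Kernel.measurable_rnDeriv κ η).ennreal_toReal).ennreal_ofReal
      _ = ∫⁻ x, genKL (κ x) (η x) ∂μ := by
          refine lintegral_congr_ae ?_
          filter_upwards [hac'] with x hx
          rw [Kernel.genKL_apply_of_ac κ η hx]
  · rw [genKL_of_not_ac hac]
    by_contra hne
    refine hac (Measure.absolutelyContinuous_compProd_right_iff.2 ?_)
    filter_upwards [ae_lt_top (Kernel.measurable_genKL κ η) (Ne.symm hne)] with x hx
    by_contra hx'
    exact hx.ne (genKL_of_not_ac hx')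

end ChainRule

/-! ### Divergence and log-likelihood ratios -/

section LogLikelihood

variable {α : Type*} [MeasurableSpace α] {μ ν : Measure α}

lemma measurable_neg_llr : Measurable fun x => -llr μ ν x := (measurable_llr μ ν).neg

variable [IsProbabilityMeasure μ] [IsProbabilityMeasure ν]

lemma lintegral_ofReal_neg_llr_le_one (hac : μ ≪ ν) :
    ∫⁻ x, ENNReal.ofReal (-llr μ ν x) ∂μ ≤ 1 := by
  rw [← lintegral_rnDeriv_mul hac measurable_neg_llr.ennreal_ofReal.aemeasurable]
  calc ∫⁻ x, μ.rnDeriv ν x * ENNReal.ofReal (-llr μ ν x) ∂ν ≤ ∫⁻ _, 1 ∂ν := by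
        refine lintegral_mono_ae ?_
        filter_upwards [Measure.rnDeriv_lt_top μ ν] with x hx
        rw [llr]
        nth_rw 1 [← ENNReal.ofReal_toReal hx.ne]
        set t := (μ.rnDeriv ν x).toReal
        have ht : 0 ≤ t := ENNReal.toReal_nonneg
        rw [← ENNReal.ofReal_mul ht, ← ENNReal.ofReal_one]
        refine ENNReal.ofReal_le_ofReal ?_
        have := klFun_nonneg ht
        rw [klFun_apply] at this
        linarith
    _ = 1 := by simp

/-- The divergence of probability measures is the extended integral of the log-likelihood ratio. -/
lemma genKL_add_lintegral_neg_llr (hac : μ ≪ ν) :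
    genKL μ ν + ∫⁻ x, ENNReal.ofReal (-llr μ ν x) ∂μ = ∫⁻ x, ENNReal.ofReal (llr μ ν x) ∂μ := by
  have hm : ∀ {a : α → ℝ}, Measurable a →
      Measurable fun x => μ.rnDeriv ν x * ENNReal.ofReal (a x) :=
    fun ha => (Measure.measurable_rnDeriv μ ν).mul ha.ennreal_ofReal
  have key : genKL μ ν + ∫⁻ x, ENNReal.ofReal (-llr μ ν x) ∂μ + 1
      = ∫⁻ x, ENNReal.ofReal (llr μ ν x) ∂μ + 1 := by
    have e1 : ∫⁻ x, μ.rnDeriv ν x ∂ν = 1 := by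
      rw [Measure.lintegral_rnDeriv hac, measure_univ]
    have e2 : ∫⁻ _, 1 ∂ν = 1 := by simp
    nth_rw 1 [← e1]
    nth_rw 1 [← e2]
    rw [genKL_of_ac hac,
      ← lintegral_rnDeriv_mul hac measurable_neg_llr.ennreal_ofReal.aemeasurable,
      ← lintegral_rnDeriv_mul hac (measurable_llr μ ν).ennreal_ofReal.aemeasurable,
      ← lintegral_add_right _ (hm measurable_neg_llr),
      ← lintegral_add_right _ (Measure.measurable_rnDeriv μ ν),
      ← lintegral_add_right _ measurable_const]
    refine lintegral_congr_ae ?_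
    filter_upwards [Measure.rnDeriv_lt_top μ ν] with x hx
    simp only [llr]
    rw [← ENNReal.ofReal_toReal hx.ne]
    set t := (μ.rnDeriv ν x).toReal
    have ht : 0 ≤ t := ENNReal.toReal_nonneg
    have hk := klFun_nonneg ht
    rw [ENNReal.toReal_ofReal ht, ← ENNReal.ofReal_mul ht, ← ENNReal.ofReal_mul ht,
      ← ENNReal.ofReal_one]
    rw [klFun_apply] at hk ⊢
    rcases le_total 0 (t * Real.log t) with h | h
    · rw [ENNReal.ofReal_of_nonpos (p := t * -Real.log t) (by linarith), add_zero,
        ← ENNReal.ofReal_add hk ht, ← ENNReal.ofReal_add h zero_le_one]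
      congr 1; ring
    · rw [ENNReal.ofReal_of_nonpos (p := t * Real.log t) h, zero_add,
        ← ENNReal.ofReal_add hk (by linarith), ← ENNReal.ofReal_add (by linarith) ht]
      congr 1; ring
  exact (ENNReal.add_left_inj ENNReal.one_ne_top).1 key

end LogLikelihood

/-! ### Differential entropy -/

section Entropy

variable {D : ℕ} {ε : ℝ}

/-- The constant `(D / 2) log (2πε)`. -/
noncomputable def logGaussConst (D : ℕ) (ε : ℝ) : ℝ := (D : ℝ) / 2 * Real.log (2 * Real.pi * ε)

lemma log_heatDensity (hε : 0 < ε) (x y : Euc D) :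
    Real.log (heatDensity ε x y) = -logGaussConst D ε - ‖x - y‖ ^ 2 / 2 / ε := by
  rw [heatDensity, Real.log_mul (by positivity) (by positivity), Real.log_exp,
    Real.log_rpow (by positivity), logGaussConst]
  ring

/-- A probability measure with finite second moment has a differential entropy in `[-∞, ∞)`, given
by its divergence from a Gaussian measure. -/
lemma diffEntropy_eq (hε : 0 < ε) (μ : Measure (Euc D)) [IsProbabilityMeasure μ] (x : Euc D)
    (hm : ∫⁻ y, ENNReal.ofReal (‖x - y‖ ^ 2 / 2 / ε) ∂μ ≠ ∞) :
    diffEntropy μ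
      = ((ENNReal.ofReal (logGaussConst D ε) + ∫⁻ y, ENNReal.ofReal (‖x - y‖ ^ 2 / 2 / ε) ∂μ
            : ℝ≥0∞) : EReal)
        - ((genKL μ (heatKernel D ε x) + ENNReal.ofReal (-logGaussConst D ε) : ℝ≥0∞) : EReal) := by
  have := isMarkovKernel_heatKernel (D := D) hε
  set K := logGaussConst D ε with hK
  set η := heatKernel D ε x with hη
  by_cases hac : μ ≪ volume
  swap
  · have hac' : ¬ μ ≪ η := fun h => hac (h.trans (heatKernel_absolutelyContinuous x))
    simp [diffEntropy, hac, genKL_of_not_ac hac', EReal.sub_top]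
  have hac' : μ ≪ η := hac.trans (volume_absolutelyContinuous_heatKernel hε x)
  have hg : Measurable fun y => ENNReal.ofReal (heatDensity ε x y) :=
    measurable_ofReal_heatDensity_right x
  have hg0 : ∀ y, ENNReal.ofReal (heatDensity ε x y) ≠ 0 := fun y => by
    simpa using heatDensity_pos hε x y
  have hlog : ∀ᵐ y ∂μ, Real.log (μ.rnDeriv volume y).toReal
      = llr μ η y + (-K - ‖x - y‖ ^ 2 / 2 / ε) := by
    have h1 := hac.ae_le (Measure.rnDeriv_withDensity_right μ volume hg.aemeasurable
      (ae_of_all _ hg0) (ae_of_all _ fun y => ENNReal.ofReal_ne_top))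
    rw [← heatKernel_apply] at h1
    filter_upwards [h1, Measure.rnDeriv_pos hac,
      hac.ae_le (Measure.rnDeriv_lt_top μ volume)] with y hy hpos hlt
    have hpos := ENNReal.toReal_pos hpos.ne' hlt.ne
    rw [llr, hy, ENNReal.toReal_mul, ENNReal.toReal_inv,
      ENNReal.toReal_ofReal (heatDensity_pos hε x y).le,
      Real.log_mul (inv_ne_zero (heatDensity_pos hε x y).ne') hpos.ne', Real.log_inv,
      log_heatDensity hε]
    ring
  have hmeas : Measurable fun y : Euc D => ENNReal.ofReal (‖x - y‖ ^ 2 / 2 / ε) := by fun_prop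
  have hl := measurable_llr μ η
  have hneg : ∫⁻ y, ENNReal.ofReal (-llr μ η y) ∂μ ≠ ∞ :=
    ne_top_of_le_ne_top ENNReal.one_ne_top (lintegral_ofReal_neg_llr_le_one hac')
  have hU : ∫⁻ y, (ENNReal.ofReal (-llr μ η y) + (ENNReal.ofReal K
        + ENNReal.ofReal (‖x - y‖ ^ 2 / 2 / ε))) ∂μ
      = ∫⁻ y, ENNReal.ofReal (-llr μ η y) ∂μ
        + (ENNReal.ofReal K + ∫⁻ y, ENNReal.ofReal (‖x - y‖ ^ 2 / 2 / ε) ∂μ) := by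
    rw [lintegral_add_left measurable_neg_llr.ennreal_ofReal, lintegral_add_left measurable_const]
    simp
  have hV : ∫⁻ y, (ENNReal.ofReal (llr μ η y) + ENNReal.ofReal (-K)) ∂μ
      = ∫⁻ y, ENNReal.ofReal (llr μ η y) ∂μ + ENNReal.ofReal (-K) := by
    rw [lintegral_add_right _ measurable_const]
    simp
  have hfin : ENNReal.ofReal K + ∫⁻ y, ENNReal.ofReal (‖x - y‖ ^ 2 / 2 / ε) ∂μ ≠ ∞ :=
    ENNReal.add_ne_top.2 ⟨ENNReal.ofReal_ne_top, hm⟩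
  have hent : diffEntropy μ
      = extIntegral μ fun y => ((-Real.log (μ.rnDeriv volume y).toReal : ℝ) : EReal) := by
    simp [diffEntropy, hac]
  rw [hent, extIntegral_eq_sub
    (u := fun y => ENNReal.ofReal (-llr μ η y) + (ENNReal.ofReal K
      + ENNReal.ofReal (‖x - y‖ ^ 2 / 2 / ε)))
    (v := fun y => ENNReal.ofReal (llr μ η y) + ENNReal.ofReal (-K))
    (measurable_neg_llr.ennreal_ofReal.add (measurable_const.add hmeas)).aemeasurable
    (hl.ennreal_ofReal.add measurable_const).aemeasurable
    (by rw [hU]; exact ENNReal.add_ne_top.2 ⟨hneg, hfin⟩), hU, hV]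
  · refine coe_sub_coe_eq_of_add_eq_add hfin (ENNReal.add_ne_top.2 ⟨hneg, hfin⟩) ?_
    rw [← genKL_add_lintegral_neg_llr hac']
    ring
  · filter_upwards [hlog] with y hy
    rw [hy]
    have hc : 0 ≤ ‖x - y‖ ^ 2 / 2 / ε := by positivity
    have hpn : ∀ a : ℝ, a = (ENNReal.ofReal a).toReal - (ENNReal.ofReal (-a)).toReal := fun a => by
      rw [ENNReal.toReal_ofReal', ENNReal.toReal_ofReal']
      exact (max_zero_sub_max_neg_zero_eq_self a).symm
    have h1 := hpn (llr μ η y)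
    have h2 := hpn K
    have h3 := ENNReal.toReal_ofReal hc
    have hcoe : ∀ a : ℝ≥0∞, a ≠ ∞ → (a : EReal) = ((a.toReal : ℝ) : EReal) := fun a ha =>
      (EReal.coe_toReal (by simpa using ha) (by simp)).symm.trans (by simp)
    rw [hcoe _ (by simp), hcoe _ (by simp), ← EReal.coe_sub,
      ENNReal.toReal_add (by simp) (by simp), ENNReal.toReal_add (by simp) (by simp),
      ENNReal.toReal_add (by simp) (by simp), h3]
    congr 1
    linarith

end Entropy

/-! ### Gibbs measures and the primal objective -/

section GibbsPlans

variable {D : ℕ} {ε : ℝ}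

lemma measurable_exp_div_sub {f ξ : Euc D → ℝ} (hf : Measurable f) (hξ : Measurable ξ) :
    Measurable fun z : Euc D × Euc D => ENNReal.ofReal (Real.exp (f z.2 / ε - ξ z.1)) := by
  fun_prop

/-- The Gibbs measure with potentials `f` and `ξ` is a tilt of the law of the pair
`(x₀, x₀ + √ε z)`. -/
lemma gibbsPlan_eq (hε : 0 < ε) (p₀ : Measure (Euc D)) [IsProbabilityMeasure p₀]
    (hp₀ : p₀ ≪ volume) {f ξ : Euc D → ℝ} (hf : Measurable f) (hξ : Measurable ξ) :
    gibbsPlan ε p₀ f ξ = (p₀ ⊗ₘ heatKernel D ε).withDensity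
      fun z => ENNReal.ofReal (Real.exp (f z.2 / ε - ξ z.1)) := by
  have := isMarkovKernel_heatKernel (D := D) hε
  have hsf : IsSFiniteKernel ((Kernel.const (Euc D) (volume : Measure (Euc D))).withDensity
    fun x y => ENNReal.ofReal (heatDensity ε x y)) :=
      (inferInstance : IsSFiniteKernel (heatKernel D ε))
  have hν : p₀ ⊗ₘ heatKernel D ε = (volume : Measure (Euc D × Euc D)).withDensity
      fun z => p₀.rnDeriv volume z.1 * ENNReal.ofReal (heatDensity ε z.1 z.2) := by
    have hr : Measurable fun z : Euc D × Euc D => p₀.rnDeriv volume z.1 :=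
      (Measure.measurable_rnDeriv p₀ volume).comp measurable_fst
    rw [heatKernel, Measure.compProd_withDensity measurable_uncurry_ofReal_heatDensity,
      Measure.compProd_const]
    nth_rw 1 [← Measure.withDensity_rnDeriv_eq p₀ volume hp₀]
    rw [prod_withDensity_left (Measure.measurable_rnDeriv p₀ volume), ← Measure.volume_eq_prod]
    exact (withDensity_mul _ hr measurable_heatDensity.ennreal_ofReal).symm
  rw [hν, gibbsPlan]
  have hr : Measurable fun z : Euc D × Euc D => p₀.rnDeriv volume z.1 *
      ENNReal.ofReal (heatDensity ε z.1 z.2) :=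
    ((Measure.measurable_rnDeriv p₀ volume).comp measurable_fst).mul
      measurable_heatDensity.ennreal_ofReal
  rw [← withDensity_mul _ hr (measurable_exp_div_sub hf hξ)]
  congr 1
  funext z
  rw [Pi.mul_apply, mul_assoc (p₀.rnDeriv volume z.1),
    ← ENNReal.ofReal_mul (heatDensity_pos hε _ _).le, heatDensity]
  congr 2
  rw [div_eq_mul_inv, ← Real.exp_neg, mul_assoc _ (Real.exp _), mul_assoc _ (Real.exp _),
    ← Real.exp_add, ← Real.exp_add]
  congr 2
  ring

lemma lintegral_stdGaussian_exp_eq (hε : 0 < ε) (p₀ : Measure (Euc D)) [IsProbabilityMeasure p₀]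
    {f ξ : Euc D → ℝ} (hf : Measurable f) (hξ : Measurable ξ) :
    ∫⁻ x₀, ∫⁻ z, ENNReal.ofReal (Real.exp (f (x₀ + Real.sqrt ε • z) / ε - ξ x₀))
        ∂(stdGaussian (Euc D)) ∂p₀
      = ∫⁻ z, ENNReal.ofReal (Real.exp (f z.2 / ε - ξ z.1)) ∂(p₀ ⊗ₘ heatKernel D ε) := by
  have := isMarkovKernel_heatKernel (D := D) hε
  rw [Measure.lintegral_compProd (measurable_exp_div_sub hf hξ)]
  refine lintegral_congr fun x => ?_
  have hm : Measurable fun y => ENNReal.ofReal (Real.exp (f y / ε - ξ x)) := by fun_prop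
  rw [lintegral_heatKernel x hm]
  exact lintegral_stdGaussian_comp_add_smul hε x hm

lemma exists_lintegral_exp_sq_heatKernel_eq (hε : 0 < ε) :
    ∃ C : ℝ≥0∞, C ≠ ∞ ∧ ∀ x : Euc D,
      ∫⁻ y, ENNReal.ofReal (Real.exp (‖x - y‖ ^ 2 / (4 * ε))) ∂(heatKernel D ε x) = C := by
  have hm : ∀ x : Euc D, Measurable fun y : Euc D =>
      ENNReal.ofReal (Real.exp (‖x - y‖ ^ 2 / (4 * ε))) := fun x => by fun_prop
  have hb : 0 < 1 / (4 * ε) := by positivity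
  refine ⟨∫⁻ y : Euc D, ENNReal.ofReal
    ((2 * Real.pi * ε) ^ (-(D : ℝ) / 2) * Real.exp (-(1 / (4 * ε)) * ‖y‖ ^ 2)), ?_, fun x => ?_⟩
  · have h := ((integrable_exp_neg_mul_sq_norm (D := D) hb).const_mul
      ((2 * Real.pi * ε) ^ (-(D : ℝ) / 2)))
    rw [← ofReal_integral_eq_lintegral_ofReal h (ae_of_all _ fun y => by positivity)]
    exact ENNReal.ofReal_ne_top
  · rw [lintegral_heatKernel x (hm x), ← lintegral_sub_left_eq_self _ x]
    refine lintegral_congr fun y => ?_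
    rw [← ENNReal.ofReal_mul (heatDensity_pos hε _ _).le, heatDensity, mul_assoc, ← Real.exp_add,
      sub_sub_cancel]
    congr 3
    field_simp
    ring

/-- Finite divergence from the Gaussian reference plan forces finite transport cost, by the entropy
inequality applied to a small multiple of the cost. -/
lemma transportCost_ne_top (hε : 0 < ε) (p₀ : Measure (Euc D)) [IsProbabilityMeasure p₀]
    (γ : Measure (Euc D × Euc D)) [IsFiniteMeasure γ]
    (h : genKL γ (p₀ ⊗ₘ heatKernel D ε) ≠ ∞) : transportCost γ ≠ ∞ := by
  have := isMarkovKernel_heatKernel (D := D) hε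
  have hu : Measurable fun z : Euc D × Euc D => ‖z.1 - z.2‖ ^ 2 / (4 * ε) := by fun_prop
  have htilt := genKL_withDensity_exp γ (p₀ ⊗ₘ heatKernel D ε) hu (v := fun _ => 0)
    measurable_const (fun z => by positivity) (fun _ => le_rfl)
  simp only [sub_zero, ENNReal.ofReal_zero, lintegral_zero, add_zero] at htilt
  have hfin : ∫⁻ z, ENNReal.ofReal (Real.exp (‖z.1 - z.2‖ ^ 2 / (4 * ε)))
      ∂(p₀ ⊗ₘ heatKernel D ε) ≠ ∞ := by
    obtain ⟨C, hC, hC'⟩ := exists_lintegral_exp_sq_heatKernel_eq (D := D) hε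
    rw [Measure.lintegral_compProd (by fun_prop)]
    simp only [hC']
    simpa using hC
  have hle : ∫⁻ z, ENNReal.ofReal (‖z.1 - z.2‖ ^ 2 / (4 * ε)) ∂γ ≠ ∞ := by
    refine ne_top_of_le_ne_top (ENNReal.add_ne_top.2 ⟨h, hfin⟩) ?_
    rw [← htilt]
    exact le_add_right (le_add_left le_rfl)
  have hcost : transportCost γ
      = ENNReal.ofReal (2 * ε) * ∫⁻ z, ENNReal.ofReal (‖z.1 - z.2‖ ^ 2 / (4 * ε)) ∂γ := by
    rw [transportCost, ← lintegral_const_mul _ hu.ennreal_ofReal]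
    refine lintegral_congr fun z => ?_
    rw [← ENNReal.ofReal_mul (by positivity)]
    congr 1
    field_simp
    ring
  rw [hcost]
  exact ENNReal.mul_ne_top ENNReal.ofReal_ne_top hle

lemma coe_eq_coe_toReal {a : ℝ≥0∞} (ha : a ≠ ∞) : (a : EReal) = ((a.toReal : ℝ) : EReal) :=
  (EReal.coe_toReal (by simpa using ha) (by simp)).symm.trans (by simp)

/-- Up to an additive constant, the primal objective is `ε` times the divergence from the Gaussian
reference plan. -/
lemma eotObjective_eq (hε : 0 < ε) (p₀ : Measure (Euc D)) [IsProbabilityMeasure p₀]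
    (γ : Measure (Euc D × Euc D)) [IsFiniteMeasure γ] (hγ : γ.fst = p₀)
    (hcost : transportCost γ ≠ ∞) :
    eotObjective ε γ = ((ENNReal.ofReal ε * genKL γ (p₀ ⊗ₘ heatKernel D ε) : ℝ≥0∞) : EReal)
      - ((ε * logGaussConst D ε : ℝ) : EReal) := by
  have := isMarkovKernel_heatKernel (D := D) hε
  set K := logGaussConst D ε with hK
  set κ := γ.condKernel with hκ
  have hdis : p₀ ⊗ₘ κ = γ := by rw [← hγ]; exact γ.disintegrate κ
  have hc : Measurable fun z : Euc D × Euc D => ENNReal.ofReal (‖z.1 - z.2‖ ^ 2 / 2 / ε) := by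
    fun_prop
  have hcm : Measurable fun x : Euc D => ∫⁻ y, ENNReal.ofReal (‖x - y‖ ^ 2 / 2 / ε) ∂(κ x) :=
    Measurable.lintegral_kernel_prod_right (κ := κ) hc
  have hcint : ∫⁻ x, ∫⁻ y, ENNReal.ofReal (‖x - y‖ ^ 2 / 2 / ε) ∂(κ x) ∂p₀
      = ENNReal.ofReal ε⁻¹ * transportCost γ := by
    have h1 : ∫⁻ z, ENNReal.ofReal (‖z.1 - z.2‖ ^ 2 / 2 / ε) ∂(p₀ ⊗ₘ κ)
        = ∫⁻ x, ∫⁻ y, ENNReal.ofReal (‖x - y‖ ^ 2 / 2 / ε) ∂(κ x) ∂p₀ :=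
      Measure.lintegral_compProd hc
    rw [← h1, hdis, transportCost, ← lintegral_const_mul _ (by fun_prop)]
    refine lintegral_congr fun z => ?_
    rw [← ENNReal.ofReal_mul (by positivity)]
    congr 1
    ring
  have hcfin : ENNReal.ofReal ε⁻¹ * transportCost γ ≠ ∞ :=
    ENNReal.mul_ne_top ENNReal.ofReal_ne_top hcost
  have hKL : ∫⁻ x, genKL (κ x) (heatKernel D ε x) ∂p₀ = genKL γ (p₀ ⊗ₘ heatKernel D ε) := by
    rw [← genKL_compProd, hdis]
  have hgm := Kernel.measurable_genKL κ (heatKernel D ε)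
  have hU : ∫⁻ x, (ENNReal.ofReal K + ∫⁻ y, ENNReal.ofReal (‖x - y‖ ^ 2 / 2 / ε) ∂(κ x)) ∂p₀
      = ENNReal.ofReal K + ENNReal.ofReal ε⁻¹ * transportCost γ := by
    rw [lintegral_add_left measurable_const, hcint]; simp
  have hV : ∫⁻ x, (genKL (κ x) (heatKernel D ε x) + ENNReal.ofReal (-K)) ∂p₀
      = genKL γ (p₀ ⊗ₘ heatKernel D ε) + ENNReal.ofReal (-K) := by
    rw [lintegral_add_right _ measurable_const, hKL]; simp
  have hint : extIntegral γ.fst (fun x₀ => diffEntropy (κ x₀))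
      = ((ENNReal.ofReal K + ENNReal.ofReal ε⁻¹ * transportCost γ : ℝ≥0∞) : EReal)
        - ((genKL γ (p₀ ⊗ₘ heatKernel D ε) + ENNReal.ofReal (-K) : ℝ≥0∞) : EReal) := by
    rw [hγ, ← hU, ← hV]
    refine extIntegral_eq_sub (measurable_const.add hcm).aemeasurable
      (hgm.add measurable_const).aemeasurable ?_ ?_
    · rw [hU]; exact ENNReal.add_ne_top.2 ⟨ENNReal.ofReal_ne_top, hcfin⟩
    · filter_upwards [ae_lt_top hcm (by rw [hcint]; exact hcfin)] with x hx
      exact diffEntropy_eq hε (κ x) x hx.ne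
  rw [eotObjective, if_neg hcost, hint]
  have hε' : (ENNReal.ofReal ε).toReal = ε := ENNReal.toReal_ofReal hε.le
  have hεi : (ENNReal.ofReal ε⁻¹).toReal = ε⁻¹ := ENNReal.toReal_ofReal (by positivity)
  by_cases hG : genKL γ (p₀ ⊗ₘ heatKernel D ε) = ∞
  · rw [hG, top_add, ENNReal.mul_top (by simpa using hε)]
    rw [coe_eq_coe_toReal hcost, EReal.coe_ennreal_top, EReal.sub_top,
      EReal.coe_mul_bot_of_pos hε, EReal.coe_sub_bot, EReal.top_sub_coe]
  · have hA : ENNReal.ofReal K + ENNReal.ofReal ε⁻¹ * transportCost γ ≠ ∞ :=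
      ENNReal.add_ne_top.2 ⟨ENNReal.ofReal_ne_top, hcfin⟩
    have hB : genKL γ (p₀ ⊗ₘ heatKernel D ε) + ENNReal.ofReal (-K) ≠ ∞ :=
      ENNReal.add_ne_top.2 ⟨hG, ENNReal.ofReal_ne_top⟩
    have hC : ENNReal.ofReal ε * genKL γ (p₀ ⊗ₘ heatKernel D ε) ≠ ∞ :=
      ENNReal.mul_ne_top ENNReal.ofReal_ne_top hG
    rw [coe_eq_coe_toReal hcost, coe_eq_coe_toReal hA, coe_eq_coe_toReal hB, coe_eq_coe_toReal hC,
      ENNReal.toReal_add ENNReal.ofReal_ne_top hcfin, ENNReal.toReal_add hG ENNReal.ofReal_ne_top,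
      ENNReal.toReal_mul, ENNReal.toReal_mul, hε', hεi,
      ENNReal.toReal_ofReal', ENNReal.toReal_ofReal', ← EReal.coe_sub, ← EReal.coe_mul,
      ← EReal.coe_sub, ← EReal.coe_sub]
    congr 1
    have hpn : K = max K 0 - max (-K) 0 := (max_zero_sub_max_neg_zero_eq_self K).symm
    have : ε * ε⁻¹ = 1 := mul_inv_cancel₀ hε.ne'
    linear_combination (-(transportCost γ).toReal) * this + ε * hpn

end GibbsPlans

/-! ### The optimal normalization of a Gibbs measure -/

section OptimalNormalization

variable {D : ℕ} {ε : ℝ}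

lemma measurable_partitionFn {f : Euc D → ℝ} (hf : Measurable f) :
    Measurable (partitionFn ε f) := by
  unfold partitionFn
  exact Measurable.lintegral_prod_right' (f := fun z : Euc D × Euc D =>
    ENNReal.ofReal (Real.exp ((f z.2 - ‖z.1 - z.2‖ ^ 2 / 2) / ε))) (by fun_prop)

lemma measurable_xiOpt {f : Euc D → ℝ} (hf : Measurable f) : Measurable (xiOpt ε f) :=
  (Real.measurable_log.comp (measurable_partitionFn hf).ennreal_toReal).sub_const _

lemma partitionFn_ne_zero {f : Euc D → ℝ} (hf : Measurable f) (x : Euc D) :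
    partitionFn ε f x ≠ 0 := by
  intro h
  rw [partitionFn, lintegral_eq_zero_iff (by fun_prop)] at h
  obtain ⟨y, hy⟩ := h.exists
  simp only [Pi.zero_apply, ENNReal.ofReal_eq_zero] at hy
  exact absurd hy (not_le.2 (Real.exp_pos _))

lemma lintegral_exp_heatKernel_eq (hε : 0 < ε) {f : Euc D → ℝ} (hf : Measurable f) (x : Euc D)
    (c : ℝ) : ∫⁻ y, ENNReal.ofReal (Real.exp (f y / ε - c)) ∂(heatKernel D ε x)
      = ENNReal.ofReal ((2 * Real.pi * ε) ^ (-(D : ℝ) / 2) * Real.exp (-c))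
        * partitionFn ε f x := by
  rw [lintegral_heatKernel x (by fun_prop), partitionFn, ← lintegral_const_mul _ (by fun_prop)]
  refine lintegral_congr fun y => ?_
  rw [← ENNReal.ofReal_mul (heatDensity_pos hε _ _).le, ← ENNReal.ofReal_mul (by positivity),
    heatDensity, mul_assoc _ (Real.exp _), mul_assoc _ (Real.exp _), ← Real.exp_add,
    ← Real.exp_add]
  congr 3
  ring

lemma lintegral_exp_xiOpt_heatKernel (hε : 0 < ε) {f : Euc D → ℝ} (hf : Measurable f) {x : Euc D}
    (hZ : partitionFn ε f x ≠ ∞) :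
    ∫⁻ y, ENNReal.ofReal (Real.exp (f y / ε - xiOpt ε f x)) ∂(heatKernel D ε x) = 1 := by
  have hpos : 0 < (partitionFn ε f x).toReal := ENNReal.toReal_pos (partitionFn_ne_zero hf x) hZ
  rw [lintegral_exp_heatKernel_eq hε hf]
  nth_rw 1 [← ENNReal.ofReal_toReal hZ]
  rw [← ENNReal.ofReal_mul (by positivity), xiOpt, neg_sub, Real.exp_sub, Real.exp_log hpos]
  have h1 : Real.exp ((D : ℝ) / 2 * Real.log (2 * Real.pi * ε))
      = (2 * Real.pi * ε) ^ ((D : ℝ) / 2) := by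
    rw [Real.rpow_def_of_pos (by positivity), mul_comm]
  have h2 : (2 * Real.pi * ε) ^ (-(D : ℝ) / 2) * (2 * Real.pi * ε) ^ ((D : ℝ) / 2) = 1 := by
    rw [← Real.rpow_add (by positivity)]
    have : -(D : ℝ) / 2 + (D : ℝ) / 2 = 0 := by ring
    rw [this, Real.rpow_zero]
  rw [h1, ← ENNReal.ofReal_one]
  congr 1
  rw [← mul_div_assoc, h2]
  field_simp

/-- Among all normalizations `ξ` of a Gibbs measure, the one that makes the conditional laws
probability measures is closest to every coupling: replacing it by `ξ* - a` adds
`𝔼_{p₀} (exp a - 1 - a)` to the divergence. -/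
lemma genKL_gibbsPlanOpt_le (hε : 0 < ε) (p₀ : Measure (Euc D)) [IsProbabilityMeasure p₀]
    (hp₀ : p₀ ≪ volume) (γ : Measure (Euc D × Euc D)) [IsFiniteMeasure γ] (hγ : γ.fst = p₀)
    {f ξ : Euc D → ℝ} (hf : Measurable f) (hξ : Measurable ξ) :
    genKL γ (gibbsPlanOpt ε p₀ f) ≤ genKL γ (gibbsPlan ε p₀ f ξ) := by
  have := isMarkovKernel_heatKernel (D := D) hε
  by_cases hKL : genKL γ (gibbsPlan ε p₀ f ξ) = ∞
  · rw [hKL]; exact le_top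
  have hξo := measurable_xiOpt (ε := ε) hf
  have hm := measurable_exp_div_sub (ε := ε) hf hξ
  have hmo := measurable_exp_div_sub (ε := ε) hf hξo
  have hG := gibbsPlan_eq hε p₀ hp₀ hf hξ
  have hGo : gibbsPlanOpt ε p₀ f = _ := gibbsPlan_eq hε p₀ hp₀ hf hξo
  -- The Gibbs measure has finite mass, so the partition function is finite almost everywhere.
  have hmass : ∫⁻ x, ∫⁻ y, ENNReal.ofReal (Real.exp (f y / ε - ξ x)) ∂(heatKernel D ε x) ∂p₀
      ≠ ∞ := by
    have : SigmaFinite (gibbsPlan ε p₀ f ξ) := by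
      rw [hG]; exact SigmaFinite.withDensity_of_ne_top (ae_of_all _ fun _ => ENNReal.ofReal_ne_top)
    have h := (measure_univ_lt_top_of_genKL_ne_top hKL).ne
    rw [hG, withDensity_apply _ MeasurableSet.univ, setLIntegral_univ,
      Measure.lintegral_compProd hm] at h
    exact h
  have hZ : ∀ᵐ x ∂p₀, partitionFn ε f x ≠ ∞ := by
    have hm' : Measurable fun x =>
        ∫⁻ y, ENNReal.ofReal (Real.exp (f y / ε - ξ x)) ∂(heatKernel D ε x) :=
      Measurable.lintegral_kernel_prod_right (κ := heatKernel D ε) hm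
    filter_upwards [ae_lt_top hm' hmass] with x hx htop
    rw [lintegral_exp_heatKernel_eq hε hf, htop, ENNReal.mul_top] at hx
    · exact lt_irrefl _ hx
    · simp only [ne_eq, ENNReal.ofReal_eq_zero, not_le]
      positivity
  have hfst : ∀ {g : Euc D → ℝ≥0∞}, Measurable g →
      ∫⁻ z, g z.1 ∂(gibbsPlanOpt ε p₀ f) = ∫⁻ x, g x ∂p₀ := by
    intro g hg
    have hg' : Measurable fun z : Euc D × Euc D => g z.1 := hg.comp measurable_fst
    rw [hGo, lintegral_withDensity_eq_lintegral_mul _ hmo hg',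
      Measure.lintegral_compProd (hmo.mul hg')]
    refine lintegral_congr_ae ?_
    filter_upwards [hZ] with x hx
    simp only [Pi.mul_apply]
    rw [lintegral_mul_const _ (by fun_prop), lintegral_exp_xiOpt_heatKernel hε hf hx, one_mul]
  have hprob : gibbsPlanOpt ε p₀ f Set.univ = 1 := by
    rw [← lintegral_one, hfst (g := fun _ => 1) measurable_const]; simp
  have : IsFiniteMeasure (gibbsPlanOpt ε p₀ f) := ⟨by rw [hprob]; exact ENNReal.one_lt_top⟩
  have hγfst : ∀ {g : Euc D → ℝ≥0∞}, Measurable g → ∫⁻ z, g z.1 ∂γ = ∫⁻ x, g x ∂p₀ := by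
    intro g hg
    rw [← hγ, Measure.fst, lintegral_map hg measurable_fst]
  let a : Euc D → ℝ := fun x => xiOpt ε f x - ξ x
  have ham : Measurable a := hξo.sub hξ
  have hpn : ∀ x, max (a x) 0 - max (-a x) 0 = a x := fun x => max_zero_sub_max_neg_zero_eq_self _
  have hGtilt : gibbsPlan ε p₀ f ξ = (gibbsPlanOpt ε p₀ f).withDensity
      fun z => ENNReal.ofReal (Real.exp (max (a z.1) 0 - max (-a z.1) 0)) := by
    have hem : Measurable fun z : Euc D × Euc D =>
        ENNReal.ofReal (Real.exp (max (a z.1) 0 - max (-a z.1) 0)) := by fun_prop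
    rw [hG, hGo, ← withDensity_mul _ hmo hem]
    congr 1
    funext z
    rw [Pi.mul_apply, ← ENNReal.ofReal_mul (Real.exp_pos _).le, ← Real.exp_add, hpn]
    congr 2
    ring
  have htilt := genKL_withDensity_exp γ (gibbsPlanOpt ε p₀ f)
    (u := fun z => max (a z.1) 0) (v := fun z => max (-a z.1) 0) (by fun_prop) (by fun_prop)
    (fun z => le_max_right _ _) (fun z => le_max_right _ _)
  rw [← hGtilt, hprob, hγfst (g := fun x => ENNReal.ofReal (max (a x) 0)) (by fun_prop),
    hγfst (g := fun x => ENNReal.ofReal (max (-a x) 0)) (by fun_prop),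
    hfst (g := fun x => ENNReal.ofReal (Real.exp (max (a x) 0 - max (-a x) 0))) (by fun_prop),
    add_assoc, add_assoc] at htilt
  set U := ∫⁻ x, ENNReal.ofReal (max (a x) 0) ∂p₀ with hU
  set V := ∫⁻ x, ENNReal.ofReal (max (-a x) 0) ∂p₀ with hV
  set E := ∫⁻ x, ENNReal.ofReal (Real.exp (max (a x) 0 - max (-a x) 0)) ∂p₀ with hE
  -- This is the inequality `1 + a ≤ exp a`, integrated.
  have hle : U + 1 ≤ V + E := by
    have h1 : ∫⁻ _, ENNReal.ofReal 1 ∂p₀ = 1 := by simp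
    rw [← h1, hU, hV, hE, ← lintegral_add_right _ measurable_const,
      ← lintegral_add_left (by fun_prop)]
    refine lintegral_mono fun x => ?_
    rw [← ENNReal.ofReal_add (le_max_right _ _) zero_le_one,
      ← ENNReal.ofReal_add (le_max_right _ _) (Real.exp_pos _).le]
    refine ENNReal.ofReal_le_ofReal ?_
    have := Real.add_one_le_exp (max (a x) 0 - max (-a x) 0)
    linarith
  have hEfin : E ≠ ∞ := by
    have h1 : ∫⁻ z, ENNReal.ofReal (Real.exp (max (a z.1) 0 - max (-a z.1) 0))
        ∂(gibbsPlanOpt ε p₀ f) = gibbsPlan ε p₀ f ξ Set.univ := by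
      rw [hGtilt, withDensity_apply _ MeasurableSet.univ, setLIntegral_univ]
    rw [hE, ← hfst (g := fun x => ENNReal.ofReal (Real.exp (max (a x) 0 - max (-a x) 0)))
      (by fun_prop), h1, hG, withDensity_apply _ MeasurableSet.univ, setLIntegral_univ,
      Measure.lintegral_compProd hm]
    exact hmass
  have hUfin : U ≠ ∞ := by
    refine ne_top_of_le_ne_top (ENNReal.add_ne_top.2 ⟨hEfin, ENNReal.one_ne_top⟩) ?_
    have h1 : ∫⁻ _, ENNReal.ofReal 1 ∂p₀ = 1 := by simp
    rw [← h1, hE, hU, ← lintegral_add_right _ measurable_const]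
    refine lintegral_mono fun x => ?_
    rw [← ENNReal.ofReal_add (Real.exp_pos _).le zero_le_one]
    refine ENNReal.ofReal_le_ofReal ?_
    rw [hpn]
    have := Real.add_one_le_exp (a x)
    have := Real.exp_pos (a x)
    exact max_le (by linarith) (by linarith)
  have hVE : V + E ≠ ∞ := by
    refine ne_top_of_le_ne_top (b := genKL γ (gibbsPlan ε p₀ f ξ) + (U + 1)) ?_ ?_
    · exact ENNReal.add_ne_top.2 ⟨hKL, ENNReal.add_ne_top.2 ⟨hUfin, ENNReal.one_ne_top⟩⟩
    · rw [htilt]; exact le_add_self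
  refine (ENNReal.add_le_add_iff_right hVE).1 ?_
  rw [← htilt]
  gcongr

end OptimalNormalization

/-! ### Duality for the entropic transport problem -/

section Duality

variable {D : ℕ} {ε : ℝ}

lemma extIntegral_coe {α : Type*} [MeasurableSpace α] (μ : Measure α) (g : α → ℝ) :
    extIntegral μ (fun x => (g x : EReal)) = ((∫⁻ x, ENNReal.ofReal (g x) ∂μ : ℝ≥0∞) : EReal)
      - ((∫⁻ x, ENNReal.ofReal (-g x) ∂μ : ℝ≥0∞) : EReal) := by
  simp only [extIntegral, ← EReal.coe_neg, EReal.real_coe_toENNReal]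

lemma extIntegral_coe_of_integrable {α : Type*} [MeasurableSpace α] {μ : Measure α} {g : α → ℝ}
    (hg : Integrable g μ) : extIntegral μ (fun x => (g x : EReal)) = ((∫ x, g x ∂μ : ℝ) : EReal) := by
  have hneg : ∫⁻ x, ENNReal.ofReal (-g x) ∂μ ≠ ∞ := hg.neg.lintegral_lt_top.ne
  rw [extIntegral_coe, coe_eq_coe_toReal hg.lintegral_lt_top.ne, coe_eq_coe_toReal hneg, ← EReal.coe_sub,
    integral_eq_lintegral_pos_part_sub_lintegral_neg_part hg]

/-- The positive part of the variational objective, up to an additive constant. -/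
noncomputable def objectivePos {D : ℕ} (ε : ℝ) (p₀ p₁ : Measure (Euc D)) (f ξ : Euc D → ℝ) :
    ℝ≥0∞ :=
  ∫⁻ y, ENNReal.ofReal (f y) ∂p₁ + ENNReal.ofReal ε * ∫⁻ x, ENNReal.ofReal (-ξ x) ∂p₀
    + ENNReal.ofReal ε

/-- The negative part of the variational objective, up to an additive constant. -/
noncomputable def objectiveNeg {D : ℕ} (ε : ℝ) (p₀ p₁ : Measure (Euc D)) (f ξ : Euc D → ℝ) :
    ℝ≥0∞ :=
  ∫⁻ y, ENNReal.ofReal (-f y) ∂p₁ + ENNReal.ofReal ε * ∫⁻ x, ENNReal.ofReal (ξ x) ∂p₀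
    + ENNReal.ofReal ε *
      ∫⁻ z, ENNReal.ofReal (Real.exp (f z.2 / ε - ξ z.1)) ∂(p₀ ⊗ₘ heatKernel D ε)

lemma objectivePos_ne_top {p₀ p₁ : Measure (Euc D)} {f ξ : Euc D → ℝ}
    (hf : ∫⁻ y, ENNReal.ofReal (f y) ∂p₁ ≠ ∞) (hξ : ∫⁻ x, ENNReal.ofReal (-ξ x) ∂p₀ ≠ ∞) :
    objectivePos ε p₀ p₁ f ξ ≠ ∞ := by
  simp [objectivePos, hf, hξ, ENNReal.mul_eq_top]

lemma varObjective_eq_sub (hε : 0 < ε) (p₀ p₁ : Measure (Euc D)) [IsProbabilityMeasure p₀]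
    {f ξ : Euc D → ℝ} (hfm : Measurable f) (hξm : Measurable ξ)
    (hf : ∫⁻ y, ENNReal.ofReal (f y) ∂p₁ ≠ ∞) (hξ : ∫⁻ x, ENNReal.ofReal (-ξ x) ∂p₀ ≠ ∞) :
    varObjective ε p₀ p₁ f ξ = (objectivePos ε p₀ p₁ f ξ : EReal) - objectiveNeg ε p₀ p₁ f ξ
      - ((ε * logGaussConst D ε : ℝ) : EReal) := by
  have hε' : (ENNReal.ofReal ε).toReal = ε := ENNReal.toReal_ofReal hε.le
  have he0 : ENNReal.ofReal ε ≠ 0 := by simpa using hε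
  rw [varObjective, extIntegral_coe, extIntegral_coe, lintegral_stdGaussian_exp_eq hε p₀ hfm hξm,
    objectivePos, objectiveNeg]
  set F := ∫⁻ y, ENNReal.ofReal (f y) ∂p₁
  set F' := ∫⁻ y, ENNReal.ofReal (-f y) ∂p₁
  set X := ∫⁻ x, ENNReal.ofReal (ξ x) ∂p₀
  set X' := ∫⁻ x, ENNReal.ofReal (-ξ x) ∂p₀
  set M := ∫⁻ z, ENNReal.ofReal (Real.exp (f z.2 / ε - ξ z.1)) ∂(p₀ ⊗ₘ heatKernel D ε)
  by_cases hF' : F' = ∞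
  · rw [hF', top_add, top_add]
    simp only [EReal.coe_ennreal_top, EReal.sub_top, EReal.add_bot, EReal.bot_sub]
  by_cases hX : X = ∞
  · rw [hX, ENNReal.mul_top he0, add_top, top_add, coe_eq_coe_toReal hξ]
    simp only [EReal.coe_ennreal_top, EReal.sub_top, EReal.bot_sub, EReal.top_sub_coe,
      EReal.coe_mul_top_of_pos hε]
  by_cases hM : M = ∞
  · rw [hM, ENNReal.mul_top he0, add_top]
    simp only [EReal.coe_ennreal_top, EReal.sub_top, EReal.bot_sub, EReal.coe_mul_top_of_pos hε]
  have h1 : ENNReal.ofReal ε * X' ≠ ∞ := ENNReal.mul_ne_top ENNReal.ofReal_ne_top hξ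
  have h2 : ENNReal.ofReal ε * X ≠ ∞ := ENNReal.mul_ne_top ENNReal.ofReal_ne_top hX
  have h3 : ENNReal.ofReal ε * M ≠ ∞ := ENNReal.mul_ne_top ENNReal.ofReal_ne_top hM
  have h4 := ENNReal.add_ne_top.2 ⟨hf, h1⟩
  have h5 := ENNReal.add_ne_top.2 ⟨hF', h2⟩
  rw [coe_eq_coe_toReal hf, coe_eq_coe_toReal hξ, coe_eq_coe_toReal hF', coe_eq_coe_toReal hX,
    coe_eq_coe_toReal hM,
    coe_eq_coe_toReal (ENNReal.add_ne_top.2 ⟨h4, ENNReal.ofReal_ne_top⟩),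
    coe_eq_coe_toReal (ENNReal.add_ne_top.2 ⟨h5, h3⟩),
    ENNReal.toReal_add h4 ENNReal.ofReal_ne_top, ENNReal.toReal_add hf h1,
    ENNReal.toReal_add h5 h3, ENNReal.toReal_add hF' h2,
    ENNReal.toReal_mul, ENNReal.toReal_mul, ENNReal.toReal_mul, hε', logGaussConst]
  simp only [← EReal.coe_sub, ← EReal.coe_mul, ← EReal.coe_add]
  congr 1
  ring

/-- The divergence of a coupling from a Gibbs measure splits into its divergence from the Gaussian
reference plan and the variational objective. -/
lemma mul_genKL_gibbsPlan_add (hε : 0 < ε) {p₀ p₁ : Measure (Euc D)} [IsProbabilityMeasure p₀]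
    (hp₀ : p₀ ≪ volume) {γ : Measure (Euc D × Euc D)} [IsFiniteMeasure γ]
    (hγ : IsCoupling p₀ p₁ γ) {f ξ : Euc D → ℝ} (hf : Measurable f) (hξ : Measurable ξ) :
    ENNReal.ofReal ε * genKL γ (gibbsPlan ε p₀ f ξ) + objectivePos ε p₀ p₁ f ξ
      = ENNReal.ofReal ε * genKL γ (p₀ ⊗ₘ heatKernel D ε) + objectiveNeg ε p₀ p₁ f ξ := by
  have := isMarkovKernel_heatKernel (D := D) hε
  have hpn : ∀ b : ℝ, max b 0 - max (-b) 0 = b := max_zero_sub_max_neg_zero_eq_self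
  let u : Euc D × Euc D → ℝ := fun z => max (f z.2) 0 / ε + max (-ξ z.1) 0
  let v : Euc D × Euc D → ℝ := fun z => max (-f z.2) 0 / ε + max (ξ z.1) 0
  have hum : Measurable u := by fun_prop
  have hvm : Measurable v := by fun_prop
  have huv : ∀ z, u z - v z = f z.2 / ε - ξ z.1 := fun z => by
    have h1 := hpn (f z.2)
    have h2 := hpn (ξ z.1)
    simp only [u, v]
    rw [add_sub_add_comm, ← sub_div, h1]
    linarith
  have hint : ∀ g h : Euc D → ℝ, Measurable g → Measurable h →
      ENNReal.ofReal ε * ∫⁻ z, ENNReal.ofReal (max (g z.2) 0 / ε + max (h z.1) 0) ∂γ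
        = ∫⁻ y, ENNReal.ofReal (g y) ∂p₁ + ENNReal.ofReal ε * ∫⁻ x, ENNReal.ofReal (h x) ∂p₀ := by
    intro g h hg hh
    rw [← hγ.1, ← hγ.2, Measure.fst, Measure.snd, lintegral_map (by fun_prop) measurable_fst,
      lintegral_map (by fun_prop) measurable_snd, ← lintegral_const_mul _ (by fun_prop),
      ← lintegral_const_mul _ (by fun_prop), ← lintegral_add_left (by fun_prop)]
    refine lintegral_congr fun z => ?_
    have e : ∀ b : ℝ, ENNReal.ofReal b = ENNReal.ofReal (max b 0) := fun b => by simp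
    rw [e (g z.2), e (h z.1), ← ENNReal.ofReal_mul hε.le, ← ENNReal.ofReal_mul hε.le,
      ← ENNReal.ofReal_add (le_max_right _ _) (mul_nonneg hε.le (le_max_right _ _))]
    congr 1
    field_simp
  have htilt := genKL_withDensity_exp γ (p₀ ⊗ₘ heatKernel D ε) hum hvm
    (fun z => add_nonneg (div_nonneg (le_max_right _ _) hε.le) (le_max_right _ _))
    (fun z => add_nonneg (div_nonneg (le_max_right _ _) hε.le) (le_max_right _ _))
  simp only [huv] at htilt
  rw [← gibbsPlan_eq hε p₀ hp₀ hf hξ, measure_univ] at htilt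
  have h := congrArg (fun b => ENNReal.ofReal ε * b) htilt
  simp only [mul_add, mul_one] at h
  rw [hint f (fun x => -ξ x) hf hξ.neg, hint (fun y => -f y) ξ hf.neg hξ] at h
  rw [objectivePos, objectiveNeg, ← add_assoc, h]
  ring

/-- A real upper bound `l` of the variational objective forces a coupling with primal value at most
`l` to exist. -/
lemma exists_coupling_of_varObjective_le (hε : 0 < ε) (p₀ p₁ : Measure (Euc D))
    [IsProbabilityMeasure p₀] [IsProbabilityMeasure p₁] (l : ℝ)
    (hl : ∀ f ξ : Euc D → ℝ, Measurable f → Measurable ξ → Integrable f p₁ → Integrable ξ p₀ →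
      varObjective ε p₀ p₁ f ξ ≤ (l : EReal)) :
    ∃ Q : Measure (Euc D × Euc D), IsFiniteMeasure Q ∧ IsCoupling p₀ p₁ Q ∧
      genKL Q (p₀ ⊗ₘ heatKernel D ε) ≠ ∞ ∧
      ((ENNReal.ofReal ε * genKL Q (p₀ ⊗ₘ heatKernel D ε) : ℝ≥0∞) : EReal)
        - ((ε * logGaussConst D ε : ℝ) : EReal) ≤ l := by
  have := isMarkovKernel_heatKernel (D := D) hε
  have hdual : ∀ (φ : SimpleFunc (Euc D) ℝ) (ψ : SimpleFunc (Euc D) ℝ),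
      ∫ x, φ x ∂p₀ + ∫ y, ψ y ∂p₁ - ∫ z, Real.exp (φ z.1 + ψ z.2) ∂(p₀ ⊗ₘ heatKernel D ε) + 1
        ≤ (l + ε * logGaussConst D ε) / ε := by
    intro φ ψ
    have hfi : Integrable (fun y => ε * ψ y) p₁ :=
      (ψ.integrable_of_isFiniteMeasure).const_mul ε
    have hξi : Integrable (fun x => -φ x) p₀ := (φ.integrable_of_isFiniteMeasure).neg
    have hψm := ψ.measurable
    have hφm := φ.measurable
    have h := hl (fun y => ε * ψ y) (fun x => -φ x) (by fun_prop) (by fun_prop) hfi hξi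
    have hexp : Integrable (fun z : Euc D × Euc D => Real.exp (φ z.1 + ψ z.2))
        (p₀ ⊗ₘ heatKernel D ε) := by
      obtain ⟨C₀, h₀⟩ := SimpleFunc.exists_forall_abs_le φ
      obtain ⟨C₁, h₁⟩ := SimpleFunc.exists_forall_abs_le ψ
      refine Integrable.of_bound (C := Real.exp (C₀ + C₁)) (by fun_prop) (ae_of_all _ fun z => ?_)
      rw [Real.norm_eq_abs, Real.abs_exp, Real.exp_le_exp]
      exact add_le_add ((le_abs_self _).trans (h₀ _)) ((le_abs_self _).trans (h₁ _))
    have hM : ∫⁻ z : Euc D × Euc D, ENNReal.ofReal (Real.exp (ε * ψ z.2 / ε - -φ z.1))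
        ∂(p₀ ⊗ₘ heatKernel D ε)
        = ENNReal.ofReal (∫ z, Real.exp (φ z.1 + ψ z.2) ∂(p₀ ⊗ₘ heatKernel D ε)) := by
      rw [ofReal_integral_eq_lintegral_ofReal hexp (ae_of_all _ fun z => (Real.exp_pos _).le)]
      refine lintegral_congr fun z => ?_
      congr 2
      field_simp
      ring
    rw [varObjective, extIntegral_coe_of_integrable hfi, extIntegral_coe_of_integrable hξi,
      lintegral_stdGaussian_exp_eq hε p₀ (f := fun y => ε * ψ y) (ξ := fun x => -φ x)
        (by fun_prop) (by fun_prop), hM,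
      coe_eq_coe_toReal ENNReal.ofReal_ne_top,
      ENNReal.toReal_ofReal (integral_nonneg fun z => (Real.exp_pos _).le)] at h
    simp only [← EReal.coe_sub, ← EReal.coe_mul, ← EReal.coe_add, EReal.coe_le_coe_iff,
      integral_const_mul, integral_neg] at h
    rw [le_div_iff₀ hε, logGaussConst]
    linarith
  have hS0 : 0 ≤ (l + ε * logGaussConst D ε) / ε := by simpa using hdual 0 0
  obtain ⟨Q, hQ, h0, h1, hKL⟩ := exists_coupling_genKL_le p₀ p₁ (p₀ ⊗ₘ heatKernel D ε) _ hdual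
  have hne := ne_top_of_le_ne_top ENNReal.ofReal_ne_top hKL
  refine ⟨Q, hQ, ⟨h0, h1⟩, hne, ?_⟩
  have hr := ENNReal.toReal_mono ENNReal.ofReal_ne_top hKL
  rw [ENNReal.toReal_ofReal hS0, le_div_iff₀ hε] at hr
  rw [coe_eq_coe_toReal (ENNReal.mul_ne_top ENNReal.ofReal_ne_top hne), ENNReal.toReal_mul,
    ENNReal.toReal_ofReal hε.le, ← EReal.coe_sub, EReal.coe_le_coe_iff]
  linarith

lemma coe_sub_coe_le_of_le_add {A P N : ℝ≥0∞} (h : P ≤ A + N) :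
    (P : EReal) - N ≤ A := by
  by_cases hN : N = ∞
  · simp [hN, EReal.sub_top]
  · refine EReal.sub_le_of_le_add ?_
    rw [← EReal.coe_ennreal_add]
    exact EReal.coe_ennreal_le_coe_ennreal_iff.2 h

/-- Strong duality: the optimal value of the variational objective is the optimal value of the
primal problem. -/
lemma varOptimum_eq (hε : 0 < ε) (p₀ p₁ : Measure (Euc D)) [IsProbabilityMeasure p₀]
    [IsProbabilityMeasure p₁] (hp₀ : p₀ ≪ volume) (γ : Measure (Euc D × Euc D)) [IsFiniteMeasure γ]
    (hγ : IsEOTPlan ε p₀ p₁ γ) :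
    varOptimum ε p₀ p₁ = ((ENNReal.ofReal ε * genKL γ (p₀ ⊗ₘ heatKernel D ε) : ℝ≥0∞) : EReal)
      - ((ε * logGaussConst D ε : ℝ) : EReal) := by
  apply le_antisymm
  · refine sSup_le ?_
    rintro _ ⟨f, ξ, hf, hξ, hfi, hξi, rfl⟩
    have hfi' := hfi.lintegral_lt_top.ne
    have hξi' : ∫⁻ x, ENNReal.ofReal (-ξ x) ∂p₀ ≠ ∞ := hξi.neg.lintegral_lt_top.ne
    rw [varObjective_eq_sub hε p₀ p₁ hf hξ hfi' hξi']
    refine EReal.sub_le_sub (coe_sub_coe_le_of_le_add ?_) le_rfl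
    rw [← mul_genKL_gibbsPlan_add hε hp₀ hγ.1 hf hξ]
    exact le_add_self
  · have hmem : ∀ f ξ : Euc D → ℝ, Measurable f → Measurable ξ → Integrable f p₁ →
        Integrable ξ p₀ → varObjective ε p₀ p₁ f ξ ≤ varOptimum ε p₀ p₁ :=
      fun f ξ hf hξ hfi hξi => le_sSup ⟨f, ξ, hf, hξ, hfi, hξi, rfl⟩
    rcases eq_or_ne (varOptimum ε p₀ p₁) ⊤ with htop | htop
    · rw [htop]; exact le_top
    · have hbot : varOptimum ε p₀ p₁ ≠ ⊥ := by
        intro hbot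
        have h := hmem (fun _ => 0) (fun _ => 0) measurable_const measurable_const
          (integrable_const _) (integrable_const _)
        rw [hbot, le_bot_iff, varObjective, extIntegral_coe_of_integrable (integrable_const _),
          extIntegral_coe_of_integrable (integrable_const _)] at h
        simp only [zero_div, sub_zero, Real.exp_zero, ENNReal.ofReal_one, lintegral_const,
          measure_univ, mul_one, EReal.coe_ennreal_one, integral_zero, ← EReal.coe_one,
          ← EReal.coe_mul, ← EReal.coe_add, ← EReal.coe_sub] at h
        exact EReal.coe_ne_bot _ h
      have hcoe := EReal.coe_toReal htop hbot
      rw [← hcoe] at hmem ⊢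
      obtain ⟨Q, hQ, hQc, hQne, hQle⟩ := exists_coupling_of_varObjective_le hε p₀ p₁ _ hmem
      have hcost := transportCost_ne_top hε p₀ Q hQne
      have hopt := hγ.2 Q hQc
      rw [eotObjective_eq hε p₀ Q hQc.1 hcost] at hopt
      have hle := hopt.trans hQle
      have hcostγ : transportCost γ ≠ ∞ := by
        intro h
        rw [eotObjective, if_pos h, top_le_iff] at hle
        exact EReal.coe_ne_top _ hle
      rwa [eotObjective_eq hε p₀ γ hγ.1.1 hcostγ] at hle

lemma coe_eq_sub_sub_sub {A B P N : ℝ≥0∞} (k : ℝ) (hP : P ≠ ∞) (h : A + P = B + N) :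
    (A : EReal) = ((B : EReal) - (k : EReal)) - ((P : EReal) - N - (k : EReal)) := by
  have hA : B = ∞ ∨ N = ∞ → A = ∞ := by
    intro hBN
    have : A + P = ∞ := by rw [h]; exact ENNReal.add_eq_top.2 hBN
    exact (ENNReal.add_eq_top.1 this).resolve_right hP
  by_cases hN : N = ∞
  · rw [hA (Or.inr hN), hN]
    simp only [EReal.coe_ennreal_top, EReal.sub_top, EReal.bot_sub]
    by_cases hB : B = ∞
    · simp [hB]
    · rw [coe_eq_coe_toReal hB, ← EReal.coe_sub, EReal.coe_sub_bot]
  by_cases hB : B = ∞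
  · rw [hA (Or.inl hB), hB, coe_eq_coe_toReal hP, coe_eq_coe_toReal hN]
    rw [EReal.coe_ennreal_top, ← EReal.coe_sub, ← EReal.coe_sub, EReal.top_sub_coe,
      EReal.top_sub_coe]
  have hA' : A ≠ ∞ := by
    rintro rfl
    rw [top_add] at h
    exact ENNReal.add_ne_top.2 ⟨hB, hN⟩ h.symm
  have h' := congrArg ENNReal.toReal h
  rw [ENNReal.toReal_add hA' hP, ENNReal.toReal_add hB hN] at h'
  rw [coe_eq_coe_toReal hA', coe_eq_coe_toReal hB, coe_eq_coe_toReal hP, coe_eq_coe_toReal hN]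
  simp only [← EReal.coe_sub]
  congr 1
  linarith

end Duality

theorem mainTheorem2 (D : ℕ) (ε : ℝ) (hε : 0 < ε)
    (p₀ p₁ : Measure (Euc D)) [IsProbabilityMeasure p₀] [IsProbabilityMeasure p₁]
    (hp₀ : p₀ ≪ volume) (hp₁ : p₁ ≪ volume)
    (plan : Measure (Euc D × Euc D)) [IsProbabilityMeasure plan]
    (hplan : IsEOTPlan ε p₀ p₁ plan)
    (f ξ : Euc D → ℝ) (hf : Measurable f) (hξ : Measurable ξ) :
    ENNReal.ofReal ε * genKL plan (gibbsPlanOpt ε p₀ f)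
        ≤ ENNReal.ofReal ε * genKL plan (gibbsPlan ε p₀ f ξ) ∧
      (∫⁻ x, ENNReal.ofReal (f x) ∂p₁ < ∞ → ∫⁻ x, ENNReal.ofReal (-ξ x) ∂p₀ < ∞ →
        ((ENNReal.ofReal ε * genKL plan (gibbsPlan ε p₀ f ξ) : ℝ≥0∞) : EReal)
          = varOptimum ε p₀ p₁ - varObjective ε p₀ p₁ f ξ) := by
  refine ⟨?_, fun hfi hξi => ?_⟩
  · gcongr
    exact genKL_gibbsPlanOpt_le hε p₀ hp₀ plan hplan.1.1 hf hξ
  · rw [varOptimum_eq hε p₀ p₁ hp₀ plan hplan,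
      varObjective_eq_sub hε p₀ p₁ hf hξ hfi.ne hξi.ne]
    exact coe_eq_sub_sub_sub _ (objectivePos_ne_top hfi.ne hξi.ne)
      (mul_genKL_gibbsPlan_add hε hp₀ hplan.1 hf hξ)
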